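/- Let $\mathcal{A}$ be a von Neumann algebra acting on a Hilbert space $\mathfrak{h}$, let $\mathsf{k}$ be a Hilbert space, let $\mathcal{F}_J$ be the symmetric Fock space over $L^2(J;\mathsf{k})$ for intervals $J\subseteq\mathbb{R}_+=[0,\infty[$, and $\mathcal{F}=\mathcal{F}_{\mathbb{R}_+}$. Let $\varpi(f)$ denote the normalised exponential vectors, and let $\mathbb{S}$ be the space of step functions in $L^2(\mathbb{R}_+;\mathsf{k})$. For a vector $\psi$, $E_\psi: u\mapsto u\otimes\psi$ and $E^\psi=(E_\psi)^*$. A *bounded process in $\mathcal{A}$* is a family $X=(X_t)_{t\ge0}$ in $B(\mathfrak{h}\otimes\mathcal{F})$ such that, for all $f,g\in\mathbb{S}$ and $t\ge 0$, $E^{\varpi(f)}X_tE_{\varpi(g)}\in\mathcal{A}$ and $$E^{\varpi(f)}X_tE_{\varpi(g)}=\langle\varpi(f_{[t,\infty[}),\varpi(g_{[t,\infty[})\rangle\,E^{\varpi(f_{[0,t[})}X_tE_{\varpi(g_{[0,t[})},$$ and which is weakly measurable: $t\mapsto\langle\zeta',X_t\zeta\rangle$ is measurable for all $\zeta'\in\mathfrak{h}\otimes\mathcal{F}$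 and all $\zeta$ in the linear span of $\{u\otimes\varpi(f):u\in\mathfrak{h},f\in\mathbb{S}\}$. A *normal completely bounded process on $\mathcal{A}$* is a family $k=(k_t)_{t\ge0}$ of normal (that is, ultraweakly continuous) completely bounded linear maps $\mathcal{A}\to B(\mathfrak{h}\otimes\mathcal{F})$ such that $(k_t(a))_{t\ge0}$ is a bounded process in $\mathcal{A}$ for each $a\in\mathcal{A}$. Then $k_r(a)=k_{r)}(a)\otimes I_{[r,\infty[}$ with $k_{r)}(a)\in\mathcal{A}\,\overline{\otimes}\,B(\mathcal{F}_{[0,r[})$. Put $\widehat{k}_r=k_{r)}\,\overline{\otimes}\,\mathrm{id}_{B(\mathcal{F}_{[r,\infty[})}$ and let $\sigma_r:\mathcal{A}\,\overline{\otimes}\,B(\mathcal{F})\to\mathcal{A}\,\overline{\otimes}\,B(\mathcal{F}_{[r,\infty[})$ be the normal $*$-isomorphism with $\sigma_r(a\otimes z)=a\otimes T_rzT_r^*$, where $T_r:\mathcal{F}\to\mathcal{F}_{[r,\infty[}$ is the unitary operator with $T_r\varpi(f)=\varpi(f(\cdot-r))$. The process $k$ is a *normal completely bounded QS cocycle* if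 $k_0(a)=a\otimes I_{\mathcal{F}}$ and $k_{r+t}=\widehat{k}_r\circ\sigma_r\circ k_t$ for all $r,t\ge0$. It is a *QS flow* if, moreover, each $k_t$ is a unital $*$-homomorphism and $k$ is ultraweakly continuous, that is, $t\mapsto k_t(a)$ is ultraweakly continuous for each $a\in\mathcal{A}$. Let $j$ be a QS flow on $\mathcal{A}$ and put $J_s=\widehat{\jmath}_s\circ\sigma_s$. A *multiplier cocycle for $j$* is a bounded process $Y$ in $\mathcal{A}$ such that $Y_0=I$ and $Y_{s+t}=J_s(Y_t)Y_s$ for all $s,t\ge0$. **Proposition.** Let $Y$ and $Z$ be multiplier cocycles for the QS flow $j$ on $\mathcal{A}$, and put $k_t(a)=Y_t^*\,j_t(a)\,Z_t$ for $a\in\mathcal{A}$, $t\ge0$. (a) If $(k_t(a))_{t\ge0}$ is weakly measurable for each $a\in\mathcal{A}$, then $k$ is a normal completely bounded QS cocycle on $\mathcal{A}$. (b) If $t\mapsto Y_t\zeta$ and $t\mapsto Z_t\zeta$ are continuous for all $\zeta\in\mathfrak{h}\otimes\mathcal{F}$, then $k$ is a normal completely bounded QS cocycle on $\mathcal{A}$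 which is ultraweakly continuous and exponentially completely bounded: there are $M\ge1$ and $\beta\in\mathbb{R}$ with $\|k_t\|_{\mathrm{cb}}\le Me^{\beta t}$ for all $t\ge0$. -/

import Mathlib

open MeasureTheory Filter Topology
open scoped NNReal ENNReal InnerProductSpace TensorProduct

noncomputable section

namespace QS

universe u v

section Hilbert

variable {E E' G G' : Type*}
  [NormedAddCommGroup E] [InnerProductSpace ℂ E] [NormedAddCommGroup E'] [InnerProductSpace ℂ E']
  [NormedAddCommGroup G] [InnerProductSpace ℂ G] [NormedAddCommGroup G'] [InnerProductSpace ℂ G']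

/-- A family of vectors is total when only the zero vector is orthogonal to all of it. -/
def IsTotal {ι : Type*} (x : ι → E) : Prop :=
  ∀ z : E, (∀ i, ⟪x i, z⟫_ℂ = 0) → z = 0

theorem IsTotal.denseRange [CompleteSpace E] {ι : Type*} {x : ι → E} (hx : IsTotal x) :
    DenseRange (Finsupp.linearCombination ℂ x) := by
  have h : (LinearMap.range (Finsupp.linearCombination ℂ x)).topologicalClosure = ⊤ := by
    rw [Submodule.topologicalClosure_eq_top_iff, Submodule.eq_bot_iff]
    intro z hz
    refine hx z fun i => ?_
    refine (Submodule.mem_orthogonal _ _).1 hz _ ⟨Finsupp.single i 1, by simp⟩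
  have := (Submodule.dense_iff_topologicalClosure_eq_top).2 h
  rwa [LinearMap.coe_range] at this

theorem norm_linearCombination_eq {ι : Type*} {x : ι → E} {y : ι → E'}
    (h : ∀ i j, ⟪x i, x j⟫_ℂ = ⟪y i, y j⟫_ℂ) (a : ι →₀ ℂ) :
    ‖Finsupp.linearCombination ℂ y a‖ = ‖Finsupp.linearCombination ℂ x a‖ := by
  have key : ⟪Finsupp.linearCombination ℂ y a, Finsupp.linearCombination ℂ y a⟫_ℂ =
      ⟪Finsupp.linearCombination ℂ x a, Finsupp.linearCombination ℂ x a⟫_ℂ := by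
    simp only [Finsupp.linearCombination_apply, Finsupp.sum, sum_inner, inner_sum,
      inner_smul_left, inner_smul_right, h]
  rw [@norm_eq_sqrt_re_inner ℂ, @norm_eq_sqrt_re_inner ℂ, key]

/-- The unitary operator between Hilbert spaces determined by `x i ↦ y i`, for total families
with equal Gram matrices. -/
def unitaryOfGram [CompleteSpace E] [CompleteSpace E'] {ι : Type*} (x : ι → E) (y : ι → E')
    (hx : IsTotal x) (hy : IsTotal y) (h : ∀ i j, ⟪x i, x j⟫_ℂ = ⟪y i, y j⟫_ℂ) : E ≃ₗᵢ[ℂ] E' :=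
  (LinearEquiv.refl ℂ (ι →₀ ℂ)).extendOfIsometry (Finsupp.linearCombination ℂ x)
    (Finsupp.linearCombination ℂ y) hx.denseRange hy.denseRange
    fun a => norm_linearCombination_eq h a

theorem unitaryOfGram_apply [CompleteSpace E] [CompleteSpace E'] {ι : Type*} (x : ι → E)
    (y : ι → E') (hx : IsTotal x) (hy : IsTotal y) (h : ∀ i j, ⟪x i, x j⟫_ℂ = ⟪y i, y j⟫_ℂ)
    (i : ι) : unitaryOfGram x y hx hy h (x i) = y i := by
  have := (LinearEquiv.refl ℂ (ι →₀ ℂ)).extendOfIsometry_eq (Finsupp.linearCombination ℂ x)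
    (Finsupp.linearCombination ℂ y) hx.denseRange hy.denseRange
    (fun a => norm_linearCombination_eq h a) (Finsupp.single i 1)
  simpa [unitaryOfGram] using this

section

variable (E G)

/-- The Hilbert space tensor product: the completion of the algebraic tensor product. -/
def HTensor : Type _ := UniformSpace.Completion (E ⊗[ℂ] G)

instance : NormedAddCommGroup (HTensor E G) :=
  inferInstanceAs (NormedAddCommGroup (UniformSpace.Completion (E ⊗[ℂ] G)))

instance : InnerProductSpace ℂ (HTensor E G) :=
  inferInstanceAs (InnerProductSpace ℂ (UniformSpace.Completion (E ⊗[ℂ] G)))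

instance : CompleteSpace (HTensor E G) :=
  inferInstanceAs (CompleteSpace (UniformSpace.Completion (E ⊗[ℂ] G)))

/-- The inclusion of the algebraic tensor product. -/
def incl : (E ⊗[ℂ] G) →ₗᵢ[ℂ] HTensor E G := UniformSpace.Completion.toComplₗᵢ

theorem denseRange_incl : DenseRange (incl E G) := UniformSpace.Completion.denseRange_coe

end

/-- The simple tensor `u ⊗ ψ`. -/
def tmul (u : E) (ψ : G) : HTensor E G := incl E G (u ⊗ₜ[ℂ] ψ)

theorem inner_tmul (u u' : E) (ψ ψ' : G) :
    ⟪tmul u ψ, tmul u' ψ'⟫_ℂ = ⟪u, u'⟫_ℂ * ⟪ψ, ψ'⟫_ℂ := by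
  rw [tmul, tmul, LinearIsometry.inner_map_map, TensorProduct.inner_tmul]

/-- The tensor product `S ⊗ T` of bounded operators. -/
def opTensor (S : E →L[ℂ] E') (T : G →L[ℂ] G') : HTensor E G →L[ℂ] HTensor E' G' :=
  ((incl E' G').toContinuousLinearMap ∘L TensorProduct.mapL S T).extend
    (incl E G).toContinuousLinearMap

theorem opTensor_tmul (S : E →L[ℂ] E') (T : G →L[ℂ] G') (u : E) (ψ : G) :
    opTensor S T (tmul u ψ) = tmul (S u) (T ψ) :=
  ContinuousLinearMap.extend_eq
    ((incl E' G').toContinuousLinearMap ∘L TensorProduct.mapL S T)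
    (e := (incl E G).toContinuousLinearMap) (denseRange_incl E G)
    (incl E G).isometry.isUniformInducing (u ⊗ₜ[ℂ] ψ)

/-- The operator `E_ψ : u ↦ u ⊗ ψ`. -/
def ket (ψ : G) : E →L[ℂ] HTensor E G :=
  (incl E G).toContinuousLinearMap ∘L (TensorProduct.mkL ℂ E G).flip ψ

theorem ket_apply (ψ : G) (u : E) : ket ψ u = tmul u ψ := rfl

theorem ext_tmul {S S' : HTensor E G →L[ℂ] E'} (h : ∀ u ψ, S (tmul u ψ) = S' (tmul u ψ)) :
    S = S' := by
  refine ContinuousLinearMap.ext fun z => ?_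
  refine (denseRange_incl E G).induction_on z (isClosed_eq S.continuous S'.continuous) fun w => ?_
  induction w using TensorProduct.induction_on with
  | zero => rw [map_zero, map_zero, map_zero]
  | tmul u ψ => exact h u ψ
  | add w w' h h' => rw [map_add, map_add, map_add, h, h']

theorem isTotal_tmul : IsTotal fun p : E × G => tmul p.1 p.2 := by
  intro z hz
  have h : innerSL ℂ z = 0 := ext_tmul fun u ψ => by
    rw [innerSL_apply_apply, ← inner_conj_symm, hz (u, ψ), map_zero]; rfl
  have h' : ⟪z, z⟫_ℂ = 0 := by
    rw [← innerSL_apply_apply, h]; rfl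
  exact inner_self_eq_zero.1 h'

variable [CompleteSpace E]

/-- The operator `E^ψ`, the adjoint of `E_ψ`; it maps `u ⊗ φ` to `⟪ψ, φ⟫ u`. -/
def bra (ψ : G) : HTensor E G →L[ℂ] E := ContinuousLinearMap.adjoint (ket ψ)

theorem bra_tmul (ψ φ : G) (u : E) : bra ψ (tmul u φ) = ⟪ψ, φ⟫_ℂ • u := by
  refine ext_inner_left ℂ fun w => ?_
  rw [bra, ContinuousLinearMap.adjoint_inner_right, ket_apply, inner_tmul, inner_smul_right,
    mul_comm]

/-- The slice `E^ψ T E_φ` of an operator `T` on `E ⊗ G`. -/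
def slice (ψ φ : G) (T : HTensor E G →L[ℂ] HTensor E G) : E →L[ℂ] E :=
  bra ψ ∘L T ∘L ket φ

theorem slice_add (ψ φ : G) (S T : HTensor E G →L[ℂ] HTensor E G) :
    slice ψ φ (S + T) = slice ψ φ S + slice ψ φ T := by
  rw [slice, ContinuousLinearMap.add_comp, ContinuousLinearMap.comp_add]; rfl

theorem slice_smul (ψ φ : G) (c : ℂ) (T : HTensor E G →L[ℂ] HTensor E G) :
    slice ψ φ (c • T) = c • slice ψ φ T := by
  rw [slice, ContinuousLinearMap.smul_comp, ContinuousLinearMap.comp_smul]; rfl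

theorem inner_slice (ψ φ : G) (T : HTensor E G →L[ℂ] HTensor E G) (u w : E) :
    ⟪u, slice ψ φ T w⟫_ℂ = ⟪tmul u ψ, T (tmul w φ)⟫_ℂ := by
  change ⟪u, bra ψ (T (ket φ w))⟫_ℂ = _
  rw [bra, ContinuousLinearMap.adjoint_inner_right, ket_apply, ket_apply]

theorem IsTotal.tmul [CompleteSpace G] {ι κ : Type*} {x : ι → E} {y : κ → G} (hx : IsTotal x)
    (hy : IsTotal y) : IsTotal fun p : ι × κ => tmul (x p.1) (y p.2) := by
  intro z hz
  have h1 : ∀ (u : E) (j : κ), ⟪QS.tmul u (y j), z⟫_ℂ = 0 := by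
    intro u j
    have : bra (y j) z = 0 := hx _ fun i => by
      rw [bra, ContinuousLinearMap.adjoint_inner_right]; exact hz (i, j)
    rw [← ket_apply, ← ContinuousLinearMap.adjoint_inner_right]
    change ⟪u, bra (y j) z⟫_ℂ = 0
    rw [this, inner_zero_right]
  refine isTotal_tmul z fun p => ?_
  obtain ⟨u, ψ⟩ := p
  set L : G →L[ℂ] HTensor E G :=
    (incl E G).toContinuousLinearMap ∘L TensorProduct.mkL ℂ E G u with hL
  have : ContinuousLinearMap.adjoint L z = 0 := hy _ fun j => by
    rw [ContinuousLinearMap.adjoint_inner_right]; exact h1 u j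
  change ⟪L ψ, z⟫_ℂ = 0
  rw [← ContinuousLinearMap.adjoint_inner_right, this, inner_zero_right]

end Hilbert

section Fock

/-- A bundled complex Hilbert space. -/
structure HilbertBundle : Type (v + 1) where
  carrier : Type v
  [group : NormedAddCommGroup carrier]
  [inner : InnerProductSpace ℂ carrier]
  [complete : CompleteSpace carrier]

attribute [instance] HilbertBundle.group HilbertBundle.inner HilbertBundle.complete

variable (V : Type v) [NormedAddCommGroup V] [InnerProductSpace ℂ V]

/-- The Hilbert space tensor powers `V ⊗ ⋯ ⊗ V`; the zeroth one is one-dimensional. -/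
def tensorPowBundle : ℕ → HilbertBundle.{v}
  | 0 => ⟨EuclideanSpace ℂ PUnit.{v + 1}⟩
  | n + 1 => ⟨HTensor V (tensorPowBundle n).carrier⟩

/-- The `n`-fold Hilbert space tensor power of `V`. -/
abbrev TensorPow (n : ℕ) : Type v := (tensorPowBundle V n).carrier

variable {V}

/-- The vector `f ⊗ ⋯ ⊗ f` (`n` factors). -/
def tpow (f : V) : (n : ℕ) → TensorPow V n
  | 0 => (EuclideanSpace.single PUnit.unit 1 : EuclideanSpace ℂ PUnit.{v + 1})
  | n + 1 => (tmul f (tpow f n) : HTensor V (TensorPow V n))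

theorem inner_tpow (f g : V) (n : ℕ) : ⟪tpow f n, tpow g n⟫_ℂ = ⟪f, g⟫_ℂ ^ n := by
  induction n with
  | zero =>
    change ⟪(EuclideanSpace.single PUnit.unit 1 : EuclideanSpace ℂ PUnit.{v + 1}),
      EuclideanSpace.single PUnit.unit 1⟫_ℂ = _
    simp
  | succ n ih =>
    change ⟪(tmul f (tpow f n) : HTensor V (TensorPow V n)), tmul g (tpow g n)⟫_ℂ = _
    rw [inner_tmul, ih, pow_succ']

theorem tpow_smul (c : ℂ) (f : V) (n : ℕ) : tpow (c • f) n = c ^ n • tpow f n := by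
  induction n with
  | zero => rw [pow_zero, one_smul]; rfl
  | succ n ih =>
    change (tmul (c • f) (tpow (c • f) n) : HTensor V (TensorPow V n)) =
      c ^ (n + 1) • (tmul f (tpow f n) : HTensor V (TensorPow V n))
    rw [ih, tmul, tmul, TensorProduct.smul_tmul_smul, map_smul, pow_succ']

theorem norm_tpow (f : V) (n : ℕ) : ‖tpow f n‖ = ‖f‖ ^ n := by
  have h := inner_tpow f f n
  rw [inner_self_eq_norm_sq_to_K, inner_self_eq_norm_sq_to_K, ← pow_mul, mul_comm, pow_mul] at h
  have h' : ‖tpow f n‖ ^ 2 = (‖f‖ ^ n) ^ 2 := by exact_mod_cast h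
  exact (pow_left_inj₀ (norm_nonneg _) (by positivity) two_ne_zero).1 h'

variable (V)

/-- The symmetric (Boson) Fock space over `V`: the square-summable sequences whose `n`-th term is a
symmetric tensor, that is, lies in the closed linear span of the vectors `f ⊗ ⋯ ⊗ f`. -/
def fockSubmodule : Submodule ℂ (lp (TensorPow V) 2) where
  carrier := {x | ∀ n, x n ∈ (Submodule.span ℂ (Set.range fun f : V => tpow f n)).topologicalClosure}
  zero_mem' _ := Submodule.zero_mem _
  add_mem' hx hy n := Submodule.add_mem _ (hx n) (hy n)
  smul_mem' c _ hx n := Submodule.smul_mem _ c (hx n)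

/-- The symmetric (Boson) Fock space over `V`. -/
def Fock : Type v := fockSubmodule V

instance : NormedAddCommGroup (Fock V) := inferInstanceAs (NormedAddCommGroup (fockSubmodule V))

instance : InnerProductSpace ℂ (Fock V) := inferInstanceAs (InnerProductSpace ℂ (fockSubmodule V))

instance : CompleteSpace (Fock V) := by
  have : IsClosed (fockSubmodule V : Set (lp (TensorPow V) 2)) := by
    have : (fockSubmodule V : Set (lp (TensorPow V) 2)) = ⋂ n, {x | x n ∈
        (Submodule.span ℂ (Set.range fun f : V => tpow f n)).topologicalClosure} := by
      ext x; rw [Set.mem_iInter]; rfl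
    rw [this]
    refine isClosed_iInter fun n => ?_
    exact (Submodule.isClosed_topologicalClosure _).preimage
      (lp.evalCLM ℂ (TensorPow V) 2 n).continuous
  exact this.completeSpace_coe

variable {V}

theorem memℓp_expVec (f : V) :
    Memℓp (fun n => ((Real.sqrt n.factorial : ℂ)⁻¹ • tpow f n : TensorPow V n)) 2 := by
  rw [memℓp_gen_iff (by norm_num)]
  refine (Real.summable_pow_div_factorial (‖f‖ ^ 2)).congr fun n => ?_
  have : (0 : ℝ) ≤ n.factorial := by positivity
  simp only [norm_smul, norm_inv, Complex.norm_real, norm_tpow, Real.norm_eq_abs,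
    ENNReal.toReal_ofNat, Real.rpow_ofNat, abs_of_nonneg (Real.sqrt_nonneg _), mul_pow, inv_pow,
    Real.sq_sqrt this]
  ring

/-- The exponential vector `ε(f) = ((n!)^{-1/2} f^{⊗ n})_n`. -/
def expVec (f : V) : Fock V :=
  ⟨⟨fun n => (Real.sqrt n.factorial : ℂ)⁻¹ • tpow f n, memℓp_expVec f⟩, fun _ =>
    Submodule.smul_mem _ _ (Submodule.le_topologicalClosure _ (Submodule.subset_span ⟨f, rfl⟩))⟩

theorem hasSum_inner_expVec (f : V) (x : Fock V) :
    HasSum (fun n => (Real.sqrt n.factorial : ℂ)⁻¹ * ⟪tpow f n, x.1 n⟫_ℂ)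
      ⟪expVec f, x⟫_ℂ := by
  have h := lp.hasSum_inner (𝕜 := ℂ) (expVec f).1 x.1
  refine h.congr_fun fun n => ?_
  change _ = ⟪(Real.sqrt n.factorial : ℂ)⁻¹ • tpow f n, x.1 n⟫_ℂ
  rw [inner_smul_left, map_inv₀, Complex.conj_ofReal]

theorem inner_expVec (f g : V) : ⟪expVec f, expVec g⟫_ℂ = Complex.exp ⟪f, g⟫_ℂ := by
  have h := hasSum_inner_expVec f (expVec g)
  have h' := NormedSpace.expSeries_div_hasSum_exp (𝔸 := ℂ) ⟪f, g⟫_ℂ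
  rw [Complex.exp_eq_exp_ℂ]
  refine h.unique (h'.congr_fun fun n => ?_)
  change (Real.sqrt n.factorial : ℂ)⁻¹ *
    ⟪tpow f n, (Real.sqrt n.factorial : ℂ)⁻¹ • tpow g n⟫_ℂ = _
  have : ((Real.sqrt n.factorial : ℂ)⁻¹) * (Real.sqrt n.factorial : ℂ)⁻¹ = (n.factorial : ℂ)⁻¹ := by
    rw [← mul_inv, ← Complex.ofReal_mul, Real.mul_self_sqrt (by positivity)]; simp
  rw [inner_smul_right, inner_tpow, ← mul_assoc, this]
  ring

/-- The exponential vectors are total in the Fock space. -/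
theorem isTotal_expVec : IsTotal (expVec : V → Fock V) := by
  intro x hx
  have key : ∀ (f : V) (n : ℕ), ⟪tpow f n, x.1 n⟫_ℂ = 0 := by
    intro f
    set c : ℕ → ℂ := fun n =>
      (Real.sqrt n.factorial : ℂ)⁻¹ * ⟪tpow f n, x.1 n⟫_ℂ with hc
    have hs : ∀ z : ℂ, HasSum (fun n => z ^ n * c n) 0 := by
      intro z
      have h := hasSum_inner_expVec ((starRingEnd ℂ) z • f) x
      rw [hx] at h
      refine h.congr_fun fun n => ?_
      rw [tpow_smul, inner_smul_left, map_pow, Complex.conj_conj, hc]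
      ring
    have hp : HasFPowerSeriesOnBall (fun _ : ℂ => (0 : ℂ))
        (FormalMultilinearSeries.ofScalars ℂ c) 0 1 := by
      refine ⟨?_, by norm_num, ?_⟩
      · refine FormalMultilinearSeries.le_radius_of_summable _ ?_
        have := (hs 1).summable.norm
        simpa [FormalMultilinearSeries.ofScalars_norm] using this
      · intro y _
        have := hs y
        simpa [FormalMultilinearSeries.ofScalars_apply_eq, mul_comm] using this
    have h0 := hp.hasFPowerSeriesAt.eq_zero
    intro n
    have h1 : c n = 0 := by
      have := congrArg (fun p => ‖p n‖) h0
      simpa [FormalMultilinearSeries.ofScalars_norm] using this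
    have h2 : (Real.sqrt n.factorial : ℂ)⁻¹ ≠ 0 := by
      have : (0 : ℝ) < n.factorial := by positivity
      have := Real.sqrt_pos.2 this
      simp [this.ne']
    exact (mul_eq_zero.1 h1).resolve_left h2
  refine Subtype.ext (lp.ext (funext fun n => ?_))
  have h3 : x.1 n ∈
      (Submodule.span ℂ (Set.range fun f : V => tpow f n)).topologicalClosure := x.2 n
  have h4 : x.1 n ∈ (Submodule.span ℂ (Set.range fun f : V => tpow f n))ᗮ := by
    rw [Submodule.mem_orthogonal]
    intro u hu
    induction hu using Submodule.span_induction with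
    | mem u hu => obtain ⟨f, rfl⟩ := hu; exact key f n
    | zero => exact inner_zero_left _
    | add u w _ _ h h' => rw [inner_add_left, h, h', add_zero]
    | smul a u _ h => rw [inner_smul_left, h, mul_zero]
  rw [← Submodule.orthogonal_closure] at h4
  exact inner_self_eq_zero.1 ((Submodule.mem_orthogonal _ _).1 h4 _ h3)

/-- The normalised exponential vector `ϖ(f) = exp(-‖f‖² / 2) ε(f)`. -/
def nexpVec (f : V) : Fock V := ((Real.exp (-(‖f‖ ^ 2) / 2) : ℝ) : ℂ) • expVec f

theorem isTotal_nexpVec : IsTotal (nexpVec : V → Fock V) := by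
  intro z hz
  refine isTotal_expVec z fun f => ?_
  have h := hz f
  rw [nexpVec, inner_smul_left] at h
  exact (mul_eq_zero.1 h).resolve_left (by simp)

theorem inner_nexpVec (f g : V) : ⟪nexpVec f, nexpVec g⟫_ℂ =
    ((Real.exp (-(‖f‖ ^ 2) / 2) * Real.exp (-(‖g‖ ^ 2) / 2) : ℝ) : ℂ) * Complex.exp ⟪f, g⟫_ℂ := by
  rw [nexpVec, nexpVec, inner_smul_left, inner_smul_right, inner_expVec, Complex.conj_ofReal]
  push_cast
  ring

end Fock

section SquareIntegrable

variable (K : Type v) [NormedAddCommGroup K] [InnerProductSpace ℂ K]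

/-- The Hilbert space `L²(J; K)`, for a subset `J` of the real line. -/
abbrev L2 (J : Set ℝ) : Type v := Lp K 2 (volume.restrict J)

variable {K}

/-- The restriction of `f ∈ L²(J; K)` to a subset `J'` of `J`. -/
def res {J J' : Set ℝ} (h : J' ⊆ J) (f : L2 K J) : L2 K J' :=
  ((Lp.memLp f).mono_measure (Measure.restrict_mono h le_rfl)).toLp f

/-- The function `f_J`, which agrees with `f` on `J` and vanishes elsewhere. -/
def cut (f : L2 K (Set.Ici 0)) (J : Set ℝ) (hJ : MeasurableSet J) : L2 K (Set.Ici 0) :=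
  ((Lp.memLp f).indicator hJ).toLp (J.indicator f)

/-- The function `f_{[0, t[}`. -/
def past (t : ℝ≥0) (f : L2 K (Set.Ici 0)) : L2 K (Set.Ici 0) :=
  cut f (Set.Ico 0 (t : ℝ)) measurableSet_Ico

/-- The function `f_{[t, ∞[}`. -/
def future (t : ℝ≥0) (f : L2 K (Set.Ici 0)) : L2 K (Set.Ici 0) :=
  cut f (Set.Ici (t : ℝ)) measurableSet_Ici

theorem measurePreserving_sub (a b r : ℝ) (h : b = a + r) : MeasurePreserving (fun s : ℝ => s - r)
    (volume.restrict (Set.Ici b)) (volume.restrict (Set.Ici a)) := by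
  have := (measurePreserving_sub_right volume r).restrict_preimage
    (s := Set.Ici a) measurableSet_Ici
  rwa [Set.preimage_sub_const_Ici, ← h] at this

theorem measurePreserving_add (a b r : ℝ) (h : b = a + r) : MeasurePreserving (fun s : ℝ => s + r)
    (volume.restrict (Set.Ici a)) (volume.restrict (Set.Ici b)) := by
  have := (measurePreserving_add_right volume r).restrict_preimage
    (s := Set.Ici b) measurableSet_Ici
  rwa [Set.preimage_add_const_Ici, h, add_sub_cancel_right, ← h] at this

/-- The right shift `f ↦ f_r`, where `f_r(s) = f(s - r)` for `s ∈ [r, ∞[`, from `L²([0, ∞[; K)` to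
`L²([r, ∞[; K)`. -/
def shift (r : ℝ≥0) : L2 K (Set.Ici 0) →ₗᵢ[ℂ] L2 K (Set.Ici (r : ℝ)) :=
  Lp.compMeasurePreservingₗᵢ ℂ (fun s => s - (r : ℝ))
    (measurePreserving_sub 0 r r (zero_add _).symm)

theorem shift_surjective (r : ℝ≥0) :
    Function.Surjective (shift r : L2 K (Set.Ici 0) →ₗᵢ[ℂ] L2 K (Set.Ici (r : ℝ))) := by
  intro g
  refine ⟨Lp.compMeasurePreserving (fun s => s + (r : ℝ))
    (measurePreserving_add 0 r r (zero_add _).symm) g, ?_⟩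
  change Lp.compMeasurePreserving _ _ (Lp.compMeasurePreserving _ _ g) = g
  have hs := measurePreserving_sub 0 (r : ℝ) r (zero_add _).symm
  have ha := measurePreserving_add 0 (r : ℝ) r (zero_add _).symm
  refine Lp.ext ((Lp.coeFn_compMeasurePreserving _ hs).trans ?_)
  filter_upwards [hs.quasiMeasurePreserving.ae (Lp.coeFn_compMeasurePreserving g ha)] with s h
  simpa using h

theorem Ico_subset_Ici_zero (r : ℝ≥0) : Set.Ico 0 (r : ℝ) ⊆ Set.Ici 0 := fun _ h => h.1

theorem Ici_subset_Ici_zero (r : ℝ≥0) : Set.Ici (r : ℝ) ⊆ Set.Ici 0 :=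
  Set.Ici_subset_Ici.2 r.2

theorem inner_res (r : ℝ≥0) (f g : L2 K (Set.Ici 0)) :
    ⟪f, g⟫_ℂ = ⟪res (Ico_subset_Ici_zero r) f, res (Ico_subset_Ici_zero r) g⟫_ℂ +
      ⟪res (Ici_subset_Ici_zero r) f, res (Ici_subset_Ici_zero r) g⟫_ℂ := by
  have hres : ∀ {J : Set ℝ} (h : J ⊆ Set.Ici 0),
      ⟪res h f, res h g⟫_ℂ = ∫ s in J, ⟪f s, g s⟫_ℂ := by
    intro J h
    rw [L2.inner_def]
    refine integral_congr_ae ?_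
    filter_upwards [MemLp.coeFn_toLp ((Lp.memLp f).mono_measure (Measure.restrict_mono h le_rfl)),
      MemLp.coeFn_toLp ((Lp.memLp g).mono_measure (Measure.restrict_mono h le_rfl))] with s h1 h2
    rw [res, res, h1, h2]
  have hi : IntegrableOn (fun s => ⟪f s, g s⟫_ℂ) (Set.Ici 0) := L2.integrable_inner (𝕜 := ℂ) f g
  have hd : Disjoint (Set.Ico 0 (r : ℝ)) (Set.Ici (r : ℝ)) :=
    Set.disjoint_left.2 fun s h1 h2 => not_lt.2 h2 h1.2
  have hu : Set.Ico 0 (r : ℝ) ∪ Set.Ici (r : ℝ) = Set.Ici 0 := Set.Ico_union_Ici_eq_Ici r.2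
  rw [hres, hres, L2.inner_def, ← setIntegral_union hd measurableSet_Ici
    (hi.mono_set (Ico_subset_Ici_zero r)) (hi.mono_set (Ici_subset_Ici_zero r)), hu]

variable (K) in
/-- The step functions in `L²([0, ∞[; K)`. -/
def stepFunctions : Submodule ℂ (L2 K (Set.Ici 0)) :=
  Submodule.span ℂ {f | ∃ (a b : ℝ) (c : K), 0 ≤ a ∧
    f = indicatorConstLp 2 (measurableSet_Ico (a := a) (b := b))
      (((Measure.restrict_apply_le _ _).trans_lt measure_Ico_lt_top).ne) c}

end SquareIntegrable

section Restriction

variable {K : Type v} [NormedAddCommGroup K]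

theorem exists_res_eq (r : ℝ≥0) (f : L2 K (Set.Ico 0 (r : ℝ))) (g : L2 K (Set.Ici (r : ℝ))) :
    ∃ h : L2 K (Set.Ici 0),
      res (Ico_subset_Ici_zero r) h = f ∧ res (Ici_subset_Ici_zero r) h = g := by
  have hf : MemLp ((Set.Ico 0 (r : ℝ)).indicator f) 2 (volume.restrict (Set.Ici 0)) := by
    rw [memLp_indicator_iff_restrict measurableSet_Ico,
      Measure.restrict_restrict_of_subset (Ico_subset_Ici_zero r)]
    exact Lp.memLp f
  have hg : MemLp ((Set.Ici (r : ℝ)).indicator g) 2 (volume.restrict (Set.Ici 0)) := by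
    rw [memLp_indicator_iff_restrict measurableSet_Ici,
      Measure.restrict_restrict_of_subset (Ici_subset_Ici_zero r)]
    exact Lp.memLp g
  have hc := (hf.add hg).coeFn_toLp
  refine ⟨(hf.add hg).toLp _, ?_, ?_⟩
  · refine Lp.ext ?_
    refine (MemLp.coeFn_toLp _).trans ?_
    filter_upwards [ae_restrict_of_ae_restrict_of_subset (Ico_subset_Ici_zero r) hc,
      ae_restrict_mem measurableSet_Ico] with s h1 h2
    rw [h1, Pi.add_apply, Set.indicator_of_mem h2, Set.indicator_of_notMem, add_zero]
    exact not_le.2 h2.2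
  · refine Lp.ext ?_
    refine (MemLp.coeFn_toLp _).trans ?_
    filter_upwards [ae_restrict_of_ae_restrict_of_subset (Ici_subset_Ici_zero r) hc,
      ae_restrict_mem measurableSet_Ici] with s h1 h2
    rw [h1, Pi.add_apply, Set.indicator_of_mem h2, Set.indicator_of_notMem, zero_add]
    exact fun h3 => not_le.2 h3.2 h2

end Restriction

section Noise

variable {H : Type u} [NormedAddCommGroup H] [InnerProductSpace ℂ H]
  {K : Type v} [NormedAddCommGroup K] [InnerProductSpace ℂ K]

variable (H K) in
/-- The Hilbert space `H ⊗ 𝓕`, where `𝓕` is the Fock space over `L²([0, ∞[; K)`. -/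
abbrev SysFock : Type max u v := HTensor H (Fock (L2 K (Set.Ici 0)))

/-- The unitary operator `T_r : ϖ(f) ↦ ϖ(f_r)` from the Fock space over `L²([0, ∞[; K)` to the Fock
space over `L²([r, ∞[; K)`. -/
def fockShift (r : ℝ≥0) : Fock (L2 K (Set.Ici 0)) ≃ₗᵢ[ℂ] Fock (L2 K (Set.Ici (r : ℝ))) :=
  unitaryOfGram (fun f => nexpVec f) (fun f => nexpVec (shift r f)) isTotal_nexpVec
    (fun z hz => isTotal_nexpVec z fun g => by
      obtain ⟨f, rfl⟩ := shift_surjective r g; exact hz f)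
    (fun f g => by rw [inner_nexpVec, inner_nexpVec, LinearIsometry.norm_map,
      LinearIsometry.norm_map, LinearIsometry.inner_map_map])

theorem fockShift_nexpVec (r : ℝ≥0) (f : L2 K (Set.Ici 0)) :
    fockShift r (nexpVec f) = nexpVec (shift r f) :=
  unitaryOfGram_apply (fun f : L2 K (Set.Ici 0) => nexpVec f) (fun f => nexpVec (shift r f)) _ _ _ f

/-- The identification of `H ⊗ 𝓕` with `(H ⊗ 𝓕_{[0, r[}) ⊗ 𝓕_{[r, ∞[}`, under which `u ⊗ ε(f)`
corresponds to `(u ⊗ ε(f|_{[0, r[})) ⊗ ε(f|_{[r, ∞[})`. -/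
def fockSplit [CompleteSpace H] (r : ℝ≥0) : SysFock H K ≃ₗᵢ[ℂ]
    HTensor (HTensor H (Fock (L2 K (Set.Ico 0 (r : ℝ))))) (Fock (L2 K (Set.Ici (r : ℝ)))) :=
  unitaryOfGram (fun p : H × L2 K (Set.Ici 0) => tmul p.1 (expVec p.2))
    (fun p => tmul (tmul p.1 (expVec (res (Ico_subset_Ici_zero r) p.2)))
      (expVec (res (Ici_subset_Ici_zero r) p.2)))
    (IsTotal.tmul (x := fun u : H => u) (fun z hz => inner_self_eq_zero.1 (hz z)) isTotal_expVec)
    (fun z hz => by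
      refine IsTotal.tmul (IsTotal.tmul (x := fun u : H => u)
        (fun z hz => inner_self_eq_zero.1 (hz z)) isTotal_expVec) isTotal_expVec z ?_
      rintro ⟨⟨u, f⟩, g⟩
      obtain ⟨h, rfl, rfl⟩ := exists_res_eq r f g
      exact hz (u, h))
    (fun p q => by
      simp only [inner_tmul, inner_expVec]
      rw [inner_res r p.2 q.2, Complex.exp_add, mul_assoc])

theorem fockSplit_tmul [CompleteSpace H] (r : ℝ≥0) (u : H) (f : L2 K (Set.Ici 0)) :
    fockSplit r (tmul u (expVec f)) =
      tmul (tmul u (expVec (res (Ico_subset_Ici_zero r) f)))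
        (expVec (res (Ici_subset_Ici_zero r) f)) :=
  unitaryOfGram_apply (fun p : H × L2 K (Set.Ici 0) => tmul p.1 (expVec p.2))
    (fun p => tmul (tmul p.1 (expVec (res (Ico_subset_Ici_zero r) p.2)))
      (expVec (res (Ici_subset_Ici_zero r) p.2))) _ _ _ (u, f)

end Noise

section Operators

variable {E : Type*} [NormedAddCommGroup E] [InnerProductSpace ℂ E]
  {E₁ : Type*} [NormedAddCommGroup E₁] [InnerProductSpace ℂ E₁]

/-- The ultraweak topology on `B(E)`: the coarsest topology for which all the functionals
`T ↦ ∑ ⟪u n, T (v n)⟫`, with `∑ ‖u n‖² < ∞` and `∑ ‖v n‖² < ∞`, are continuous. -/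
abbrev ultraweak (E : Type*) [NormedAddCommGroup E] [InnerProductSpace ℂ E] :
    TopologicalSpace (E →L[ℂ] E) :=
  ⨅ (u : lp (fun _ : ℕ => E) 2) (v : lp (fun _ : ℕ => E) 2),
    TopologicalSpace.induced (fun T => ∑' n, ⟪u n, T (v n)⟫_ℂ) inferInstance

/-- The operator `W T W⋆`, for a unitary operator `W`. -/
def conjBy (W : E ≃ₗᵢ[ℂ] E₁) (T : E →L[ℂ] E) : E₁ →L[ℂ] E₁ :=
  (W : E →L[ℂ] E₁) ∘L T ∘L (W.symm : E₁ →L[ℂ] E)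

theorem conjBy_add (W : E ≃ₗᵢ[ℂ] E₁) (S T : E →L[ℂ] E) :
    conjBy W (S + T) = conjBy W S + conjBy W T := by
  ext; simp [conjBy]

theorem conjBy_smul (W : E ≃ₗᵢ[ℂ] E₁) (c : ℂ) (T : E →L[ℂ] E) :
    conjBy W (c • T) = c • conjBy W T := by
  ext; simp [conjBy]

variable [CompleteSpace E] [CompleteSpace E₁] {A : VonNeumannAlgebra E}

/-- A linear map from the von Neumann algebra `A` to `B(E₁)` is normal when it is continuous for the
ultraweak topologies. -/
def IsNormal (φ : A.toStarSubalgebra →ₗ[ℂ] (E₁ →L[ℂ] E₁)) : Prop :=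
  @Continuous _ _ ((ultraweak E).induced Subtype.val) (ultraweak E₁) φ

/-- The completely bounded norm of `φ` is at most `C`: all the maps `[a i j] ↦ [φ (a i j)]`, from
`n × n` matrices over `A` to `n × n` matrices over `B(E₁)` with their C⋆-norms, are bounded by `C`.
-/
def CBNormLE (φ : A.toStarSubalgebra →ₗ[ℂ] (E₁ →L[ℂ] E₁)) (C : ℝ) : Prop :=
  ∀ (n : ℕ) (a : Matrix (Fin n) (Fin n) A.toStarSubalgebra),
    ‖CStarMatrix.ofMatrix (a.map fun x => φ x)‖ ≤
      C * ‖CStarMatrix.ofMatrix (a.map fun x => (x : E →L[ℂ] E))‖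

/-- Completely bounded maps. -/
def IsCompletelyBounded (φ : A.toStarSubalgebra →ₗ[ℂ] (E₁ →L[ℂ] E₁)) : Prop :=
  ∃ C : ℝ, CBNormLE φ C

variable {G : Type*} [NormedAddCommGroup G] [InnerProductSpace ℂ G]

/-- `S = (φ ⊗ id) T`, expressed through slices: for all `ψ` and `χ` in `G`, the slice `E^ψ T E_χ`
lies in `A` (this says that `T` belongs to the von Neumann algebra tensor product of `A` and
`B(G)`), and `E^ψ S E_χ = φ (E^ψ T E_χ)`. -/
def IsTensorId (φ : A.toStarSubalgebra →ₗ[ℂ] (E₁ →L[ℂ] E₁))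
    (T : HTensor E G →L[ℂ] HTensor E G) (S : HTensor E₁ G →L[ℂ] HTensor E₁ G) : Prop :=
  ∀ ψ χ : G, ∃ h : slice ψ χ T ∈ A.toStarSubalgebra, slice ψ χ S = φ ⟨slice ψ χ T, h⟩

open Classical in
/-- For a normal completely bounded map `φ` from `A` to `B(E₁)`, the map `φ ⊗ id` from the von
Neumann algebra tensor product of `A` and `B(G)` to `B(E₁ ⊗ G)`: `(φ ⊗ id) T` is the unique operator
with the slices `φ (E^ψ T E_χ)`. -/
def tensorId (φ : A.toStarSubalgebra →ₗ[ℂ] (E₁ →L[ℂ] E₁))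
    (T : HTensor E G →L[ℂ] HTensor E G) : HTensor E₁ G →L[ℂ] HTensor E₁ G :=
  if h : ∃ S, IsTensorId φ T S then h.choose else 0

theorem slice_ext {S S' : HTensor E G →L[ℂ] HTensor E G}
    (h : ∀ ψ χ, slice ψ χ S = slice ψ χ S') : S = S' :=
  ext_tmul fun w χ => sub_eq_zero.1 (isTotal_tmul _ fun p => by
    rw [inner_sub_right, ← inner_slice, ← inner_slice, h, sub_self])

theorem tensorId_eq {φ : A.toStarSubalgebra →ₗ[ℂ] (E₁ →L[ℂ] E₁)}
    {T : HTensor E G →L[ℂ] HTensor E G} {S : HTensor E₁ G →L[ℂ] HTensor E₁ G}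
    (h : IsTensorId φ T S) : tensorId φ T = S := by
  have h' : ∃ S, IsTensorId φ T S := ⟨S, h⟩
  rw [tensorId, dif_pos h']
  refine slice_ext fun ψ χ => ?_
  obtain ⟨_, h1⟩ := h'.choose_spec ψ χ
  obtain ⟨_, h2⟩ := h ψ χ
  rw [h1, h2]

theorem slice_opTensor (ψ χ : G) (S : E →L[ℂ] E) (z : G →L[ℂ] G) :
    slice ψ χ (opTensor S z) = ⟪ψ, z χ⟫_ℂ • S := by
  refine ContinuousLinearMap.ext fun u => ?_
  change bra ψ (opTensor S z (ket χ u)) = _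
  rw [ket_apply, opTensor_tmul, bra_tmul]
  rfl

/-- On simple tensors, `φ ⊗ id` maps `a ⊗ z` to `φ(a) ⊗ z`. -/
theorem tensorId_opTensor (φ : A.toStarSubalgebra →ₗ[ℂ] (E₁ →L[ℂ] E₁)) (a : A.toStarSubalgebra)
    (z : G →L[ℂ] G) : tensorId φ (opTensor (a : E →L[ℂ] E) z) = opTensor (φ a) z := by
  refine tensorId_eq fun ψ χ => ?_
  have h := slice_opTensor ψ χ (a : E →L[ℂ] E) z
  refine ⟨h ▸ A.toStarSubalgebra.smul_mem a.2 _, ?_⟩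
  have h' : (⟨slice ψ χ (opTensor (a : E →L[ℂ] E) z), h ▸ A.toStarSubalgebra.smul_mem a.2 _⟩ :
      A.toStarSubalgebra) = ⟪ψ, z χ⟫_ℂ • a := Subtype.ext h
  rw [h', map_smul, slice_opTensor]

/-- The map `a ↦ R⋆ φ(a) S`. -/
def sandwich (φ : A.toStarSubalgebra →ₗ[ℂ] (E₁ →L[ℂ] E₁)) (R S : E₁ →L[ℂ] E₁) :
    A.toStarSubalgebra →ₗ[ℂ] (E₁ →L[ℂ] E₁) where
  toFun a := star R * φ a * S
  map_add' a b := by rw [map_add, mul_add, add_mul]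
  map_smul' c a := by rw [map_smul, mul_smul_comm, smul_mul_assoc, RingHom.id_apply]

end Operators

section Processes

variable {H : Type u} [NormedAddCommGroup H] [InnerProductSpace ℂ H] [CompleteSpace H]
  {K : Type v} [NormedAddCommGroup K] [InnerProductSpace ℂ K]

variable (H K) in
/-- The algebraic tensor product of `H` and the linear span of the vectors `ϖ(f)`, `f` a step
function, as a subspace of `H ⊗ 𝓕`. -/
def expDomain : Submodule ℂ (SysFock H K) :=
  Submodule.span ℂ {ζ | ∃ (u : H) (f : L2 K (Set.Ici 0)), f ∈ stepFunctions K ∧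
    ζ = tmul u (nexpVec f)}

/-- Adaptedness of a family of bounded operators on `H ⊗ 𝓕`. -/
def IsAdapted (X : ℝ≥0 → (SysFock H K →L[ℂ] SysFock H K)) : Prop :=
  ∀ f ∈ stepFunctions K, ∀ g ∈ stepFunctions K, ∀ t : ℝ≥0,
    slice (nexpVec f) (nexpVec g) (X t) =
      ⟪nexpVec (future t f), nexpVec (future t g)⟫_ℂ •
        slice (nexpVec (past t f)) (nexpVec (past t g)) (X t)

/-- Weak measurability of a family of bounded operators on `H ⊗ 𝓕`. -/
def IsWeaklyMeasurable (X : ℝ≥0 → (SysFock H K →L[ℂ] SysFock H K)) : Prop :=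
  ∀ ζ' : SysFock H K, ∀ ζ ∈ expDomain H K, Measurable fun t => ⟪ζ', X t ζ⟫_ℂ

/-- Bounded (operator) processes in the von Neumann algebra `A`. -/
structure IsBoundedProcess (A : VonNeumannAlgebra H)
    (X : ℝ≥0 → (SysFock H K →L[ℂ] SysFock H K)) : Prop where
  adapted : IsAdapted X
  weaklyMeasurable : IsWeaklyMeasurable X
  slice_mem : ∀ f ∈ stepFunctions K, ∀ g ∈ stepFunctions K, ∀ t : ℝ≥0,
    slice (nexpVec f) (nexpVec g) (X t) ∈ A

/-- Normal completely bounded (mapping) processes on `A`. -/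
structure IsNormalCBProcess (A : VonNeumannAlgebra H)
    (k : ℝ≥0 → (A.toStarSubalgebra →ₗ[ℂ] (SysFock H K →L[ℂ] SysFock H K))) : Prop where
  process : ∀ a, IsBoundedProcess A fun t => k t a
  normal : ∀ t, IsNormal (k t)
  completelyBounded : ∀ t, IsCompletelyBounded (k t)

variable {A : VonNeumannAlgebra H}

/-- The map `k_{r)}` from `A` to `B(H ⊗ 𝓕_{[0, r[})` with `k_r(a) = k_{r)}(a) ⊗ I_{[r, ∞[}`. It is
obtained by slicing with the vacuum vector `ϖ(0)` of `𝓕_{[r, ∞[}`. -/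
def pastMap (k : ℝ≥0 → (A.toStarSubalgebra →ₗ[ℂ] (SysFock H K →L[ℂ] SysFock H K))) (r : ℝ≥0) :
    A.toStarSubalgebra →ₗ[ℂ] (HTensor H (Fock (L2 K (Set.Ico 0 (r : ℝ)))) →L[ℂ]
      HTensor H (Fock (L2 K (Set.Ico 0 (r : ℝ))))) where
  toFun a := slice (nexpVec 0) (nexpVec 0) (conjBy (fockSplit r) (k r a))
  map_add' a b := by rw [map_add, conjBy_add, slice_add]
  map_smul' c a := by rw [map_smul, conjBy_smul, slice_smul, RingHom.id_apply]

/-- The map `σ_r : a ⊗ z ↦ a ⊗ T_r z T_r⋆` from operators on `H ⊗ 𝓕` to operators on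
`H ⊗ 𝓕_{[r, ∞[}`. -/
def sigma (r : ℝ≥0) (T : SysFock H K →L[ℂ] SysFock H K) :
    HTensor H (Fock (L2 K (Set.Ici (r : ℝ)))) →L[ℂ] HTensor H (Fock (L2 K (Set.Ici (r : ℝ)))) :=
  opTensor (ContinuousLinearMap.id ℂ H) (fockShift (K := K) r).toContinuousLinearEquiv ∘L T ∘L
    opTensor (ContinuousLinearMap.id ℂ H) (fockShift (K := K) r).symm.toContinuousLinearEquiv

/-- The map `k̂_r = k_{r)} ⊗ id`, with values in `B(H ⊗ 𝓕)`. -/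
def kHat (k : ℝ≥0 → (A.toStarSubalgebra →ₗ[ℂ] (SysFock H K →L[ℂ] SysFock H K))) (r : ℝ≥0)
    (T : HTensor H (Fock (L2 K (Set.Ici (r : ℝ)))) →L[ℂ]
      HTensor H (Fock (L2 K (Set.Ici (r : ℝ))))) : SysFock H K →L[ℂ] SysFock H K :=
  conjBy (fockSplit r).symm (tensorId (pastMap k r) T)

/-- Normal completely bounded quantum stochastic cocycles on `A`: `k_0(a) = a ⊗ I` and
`k_{r + t} = k̂_r ∘ σ_r ∘ k_t`. -/
structure IsQSCocycle (A : VonNeumannAlgebra H)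
    (k : ℝ≥0 → (A.toStarSubalgebra →ₗ[ℂ] (SysFock H K →L[ℂ] SysFock H K))) : Prop
    extends IsNormalCBProcess A k where
  zero : ∀ a : A.toStarSubalgebra, k 0 a = opTensor (a : H →L[ℂ] H) (ContinuousLinearMap.id ℂ _)
  add : ∀ (r t : ℝ≥0) (a : A.toStarSubalgebra), k (r + t) a = kHat k r (sigma r (k t a))

/-- Ultraweak continuity of a family of maps `k_t`: for each `a`, the map `t ↦ k_t(a)` is
ultraweakly continuous. -/
def IsUltraweaklyContinuous
    (k : ℝ≥0 → (A.toStarSubalgebra →ₗ[ℂ] (SysFock H K →L[ℂ] SysFock H K))) : Prop :=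
  ∀ a, @Continuous _ _ _ (ultraweak (SysFock H K)) fun t => k t a

/-- Quantum stochastic flows on `A`. -/
structure IsQSFlow (A : VonNeumannAlgebra H)
    (j : ℝ≥0 → (A.toStarSubalgebra →ₗ[ℂ] (SysFock H K →L[ℂ] SysFock H K))) : Prop
    extends IsQSCocycle A j where
  continuous : IsUltraweaklyContinuous j
  map_mul : ∀ t a b, j t (a * b) = j t a * j t b
  map_star : ∀ t a, j t (star a) = star (j t a)
  map_one : ∀ t, j t 1 = 1

/-- Multiplier cocycles for `j`: bounded processes `Y` in `A` with `Y_0 = I` and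
`Y_{s + t} = J_s(Y_t) Y_s`, where `J_s = ĵ_s ∘ σ_s`. -/
structure IsMultiplierCocycle (A : VonNeumannAlgebra H)
    (j : ℝ≥0 → (A.toStarSubalgebra →ₗ[ℂ] (SysFock H K →L[ℂ] SysFock H K)))
    (Y : ℝ≥0 → (SysFock H K →L[ℂ] SysFock H K)) : Prop extends IsBoundedProcess A Y where
  zero : Y 0 = 1
  add : ∀ s t : ℝ≥0, Y (s + t) = kHat j s (sigma s (Y t)) * Y s

/-- The family of maps `a ↦ Y_t⋆ j_t(a) Z_t`. -/
def perturbation (j : ℝ≥0 → (A.toStarSubalgebra →ₗ[ℂ] (SysFock H K →L[ℂ] SysFock H K)))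
    (Y Z : ℝ≥0 → (SysFock H K →L[ℂ] SysFock H K)) (t : ℝ≥0) :
    A.toStarSubalgebra →ₗ[ℂ] (SysFock H K →L[ℂ] SysFock H K) :=
  sandwich (j t) (Y t) (Z t)

/-- Strong continuity of a family of bounded operators. -/
def IsStronglyContinuous (Y : ℝ≥0 → (SysFock H K →L[ℂ] SysFock H K)) : Prop :=
  ∀ ζ, Continuous fun t => Y t ζ

/-- Exponential complete boundedness: `‖k_t‖_cb ≤ M exp(β t)` for all `t`. -/
def IsExponentiallyCB
    (k : ℝ≥0 → (A.toStarSubalgebra →ₗ[ℂ] (SysFock H K →L[ℂ] SysFock H K))) : Prop :=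
  ∃ M ≥ (1 : ℝ), ∃ β : ℝ, ∀ t : ℝ≥0, CBNormLE (k t) (M * Real.exp (β * t))

end Processes

end QS

end

/-! Write `J_r = ĵ_r ∘ σ_r`. The cocycle identity for `k_t(a) = Y_t⋆ j_t(a) Z_t` is algebra once two
facts are known: `J_r` is a `⋆`-homomorphism on the operators whose slices lie in `A`, and `k̂_r(σ_r
X) = Y_r⋆ J_r(X) Z_r`. Indeed `k_{r+t}(a) = Y_r⋆ J_r(Y_t)⋆ J_r(j_t(a)) J_r(Z_t) Z_r = Y_r⋆
J_r(k_t(a)) Z_r`.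

The second fact (`kHat_perturbation`) is adaptedness: `Y_r = y ⊗ I` and `Z_r = z ⊗ I` with `y`, `z`
acting on the past (`isAdapted_iff`), so `k_{r)} = y⋆ j_{r)}(·) z`, and factors `y⋆ ⊗ I`, `z ⊗ I`
come out of slices.

The first fact carries the analysis, since `φ ⊗ id` is specified only through slices. For a
`⋆`-homomorphism `φ`, an operator with the prescribed slices exists as a weak limit of finite
compressions, which are bounded because `φ` is completely contractive (`exists_isTensorId`).
Multiplicativity follows by inserting `I ⊗ P` between two factors, with `P` a finite-rank
projection, and letting `P` grow; here normality of `φ` is essential (`tensorId_mul`). The double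
commutant theorem identifies the domain with the commutant of `A' ⊗ I`, so it is closed under
products (`mem_tensorAlg_iff`).

Each `k_t` is normal because ultraweak functionals absorb `Y_t` and `Z_t`, and its cb-norm is at
most `‖Y_t‖ ‖Z_t‖`. Strong continuity gives bounds on compact time intervals by Banach–Steinhaus,
hence ultraweak continuity. Contractivity of `J_s` gives `‖Y_{s+t}‖ ≤ ‖Y_t‖ ‖Y_s‖`, hence
exponential growth bounds. -/

noncomputable section

namespace QS

/-! ### Operator matrices acting on direct sums -/

section MatrixNorms

variable {E : Type*} [NormedAddCommGroup E] [InnerProductSpace ℂ E] {n : ℕ}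

/-- The operator on `E ⊕ ⋯ ⊕ E` given by a matrix of operators on `E`. -/
def blockOp (M : CStarMatrix (Fin n) (Fin n) (E →L[ℂ] E)) :
    PiLp 2 (fun _ : Fin n => E) →L[ℂ] PiLp 2 (fun _ : Fin n => E) :=
  ((PiLp.continuousLinearEquiv 2 ℂ (fun _ : Fin n => E)).symm : _ →L[ℂ] _) ∘L
    ContinuousLinearMap.pi fun i => ∑ j, M i j ∘L PiLp.proj 2 (fun _ : Fin n => E) j

theorem blockOp_apply (M : CStarMatrix (Fin n) (Fin n) (E →L[ℂ] E))
    (w : PiLp 2 fun _ : Fin n => E) (i : Fin n) : blockOp M w i = ∑ j, M i j (w j) := by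
  simp [blockOp]

theorem inner_blockOp (M : CStarMatrix (Fin n) (Fin n) (E →L[ℂ] E))
    (u w : PiLp 2 fun _ : Fin n => E) :
    ⟪u, blockOp M w⟫_ℂ = ∑ i, ∑ j, ⟪u i, M i j (w j)⟫_ℂ := by
  simp only [PiLp.inner_apply, blockOp_apply, inner_sum]

variable {G : Type*} [NormedAddCommGroup G] [InnerProductSpace ℂ G]

theorem norm_sum_tmul {e : Fin n → G} (he : Orthonormal ℂ e) (w : PiLp 2 fun _ : Fin n => E) :
    ‖∑ i, tmul (w i) (e i)‖ = ‖w‖ := by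
  have : ⟪∑ i, tmul (w i) (e i), ∑ i, tmul (w i) (e i)⟫_ℂ = ⟪w, w⟫_ℂ := by
    simp only [sum_inner, inner_sum, inner_tmul, PiLp.inner_apply, orthonormal_iff_ite.1 he]
    simp
  rw [@norm_eq_sqrt_re_inner ℂ, @norm_eq_sqrt_re_inner ℂ, this]

variable [CompleteSpace E]

/-- `blockOp` as a homomorphism of `⋆`-algebras. -/
def blockHom : CStarMatrix (Fin n) (Fin n) (E →L[ℂ] E) →⋆ₙₐ[ℂ]
    (PiLp 2 (fun _ : Fin n => E) →L[ℂ] PiLp 2 (fun _ : Fin n => E)) where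
  toFun := blockOp
  map_smul' c M := by
    ext w i; simp [blockOp_apply, Finset.smul_sum]
  map_zero' := by ext w i; simp [blockOp_apply]
  map_add' M N := by ext w i; simp [blockOp_apply, Finset.sum_add_distrib]
  map_mul' M N := by
    ext w i
    simp only [blockOp_apply, CStarMatrix.mul_apply, mul_apply_eq_comp,
      sum_apply, map_sum]
    rw [Finset.sum_comm]
  map_star' M := by
    refine ContinuousLinearMap.ext fun w => ext_inner_left ℂ fun u => ?_
    rw [ContinuousLinearMap.star_eq_adjoint, ContinuousLinearMap.adjoint_inner_right,
      inner_blockOp, ← inner_conj_symm, inner_blockOp, map_sum, Finset.sum_comm]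
    simp only [map_sum, inner_conj_symm, CStarMatrix.star_apply,
      ContinuousLinearMap.star_eq_adjoint, ContinuousLinearMap.adjoint_inner_right]

/-- An injective `⋆`-homomorphism of C⋆-algebras is isometric, so the abstract C⋆-norm on matrices
is the operator norm on the direct sum. -/
theorem norm_blockOp (M : CStarMatrix (Fin n) (Fin n) (E →L[ℂ] E)) : ‖blockOp M‖ = ‖M‖ := by
  refine NonUnitalStarAlgHom.norm_map (blockHom (E := E) (n := n)) ?_ M
  intro M N h
  refine CStarMatrix.ext fun i j => ContinuousLinearMap.ext fun x => ?_
  have := congrArg (fun T => T (PiLp.single 2 j x) i) h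
  change blockOp M _ i = blockOp N _ i at this
  rw [blockOp_apply, blockOp_apply, Finset.sum_eq_single j, Finset.sum_eq_single j] at this
  · simpa using this
  all_goals simp +contextual

theorem norm_sum_inner_le (M : CStarMatrix (Fin n) (Fin n) (E →L[ℂ] E))
    (u w : PiLp 2 fun _ : Fin n => E) :
    ‖∑ i, ∑ j, ⟪u i, M i j (w j)⟫_ℂ‖ ≤ ‖M‖ * ‖u‖ * ‖w‖ := by
  rw [← inner_blockOp, ← norm_blockOp]
  calc _ ≤ ‖u‖ * ‖blockOp M w‖ := norm_inner_le_norm _ _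
    _ ≤ ‖u‖ * (‖blockOp M‖ * ‖w‖) := by gcongr; exact ContinuousLinearMap.le_opNorm _ _
    _ = _ := by ring

/-- The block operator is `V⋆ T V`, where `V w = ∑ w_i ⊗ e_i` is isometric by `norm_sum_tmul`. -/
theorem norm_slice_matrix_le {e : Fin n → G} (he : Orthonormal ℂ e)
    (T : HTensor E G →L[ℂ] HTensor E G) :
    ‖CStarMatrix.ofMatrix fun i j => slice (e i) (e j) T‖ ≤ ‖T‖ := by
  rw [← norm_blockOp]
  refine ContinuousLinearMap.opNorm_le_bound _ (norm_nonneg _) fun w => ?_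
  set M : CStarMatrix (Fin n) (Fin n) (E →L[ℂ] E) :=
    CStarMatrix.ofMatrix fun i j => slice (e i) (e j) T with hM
  have key : ∀ u, ⟪u, blockOp M w⟫_ℂ = ⟪∑ i, tmul (u i) (e i), T (∑ i, tmul (w i) (e i))⟫_ℂ := by
    intro u
    rw [inner_blockOp]
    simp only [map_sum, sum_inner, inner_sum, ← inner_slice]
    exact Finset.sum_comm
  -- The vector is tested against itself, which bounds its squared norm; one factor is then
  -- cancelled, so norm zero is treated apart.
  rcases (norm_nonneg (blockOp M w)).eq_or_lt with h | h
  · rw [← h]; positivity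
  have h1 : ‖blockOp M w‖ * ‖blockOp M w‖ ≤ ‖blockOp M w‖ * (‖T‖ * ‖w‖) := by
    rw [← inner_self_eq_norm_mul_norm (𝕜 := ℂ), key]
    refine (RCLike.re_le_norm _).trans ?_
    refine (norm_inner_le_norm _ _).trans ?_
    rw [norm_sum_tmul he]
    gcongr
    rw [← norm_sum_tmul he w]
    exact T.le_opNorm _
  exact le_of_mul_le_mul_left h1 h

end MatrixNorms

/-! ### Complete bounds for homomorphisms and their sandwiches -/

section CompletelyBounded

variable {E : Type*} [NormedAddCommGroup E] [InnerProductSpace ℂ E] [CompleteSpace E]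
  {E₁ : Type*} [NormedAddCommGroup E₁] [InnerProductSpace ℂ E₁] [CompleteSpace E₁]
  {A : VonNeumannAlgebra E}

theorem isClosed_vonNeumannAlgebra (A : VonNeumannAlgebra E) :
    IsClosed (A.toStarSubalgebra : Set (E →L[ℂ] E)) := by
  rw [VonNeumannAlgebra.coe_toStarSubalgebra, ← A.centralizer_centralizer]
  exact Set.isClosed_centralizer _

/-- Multiplicativity and compatibility with the involution. -/
structure IsStarHom (φ : A.toStarSubalgebra →ₗ[ℂ] (E₁ →L[ℂ] E₁)) : Prop where
  map_mul : ∀ a b, φ (a * b) = φ a * φ b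
  map_star : ∀ a, φ (star a) = star (φ a)

/-- A multiplicative involution preserving linear map, as a bundled homomorphism. -/
def IsStarHom.toHom {φ : A.toStarSubalgebra →ₗ[ℂ] (E₁ →L[ℂ] E₁)} (hφ : IsStarHom φ) :
    A.toStarSubalgebra →⋆ₙₐ[ℂ] (E₁ →L[ℂ] E₁) where
  toFun := φ
  map_smul' := φ.map_smul
  map_zero' := φ.map_zero
  map_add' := φ.map_add
  map_mul' := hφ.map_mul
  map_star' := hφ.map_star

theorem IsStarHom.norm_le {φ : A.toStarSubalgebra →ₗ[ℂ] (E₁ →L[ℂ] E₁)} (hφ : IsStarHom φ)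
    (a : A.toStarSubalgebra) : ‖φ a‖ ≤ ‖(a : E →L[ℂ] E)‖ := by
  have := isClosed_vonNeumannAlgebra A
  exact NonUnitalStarAlgHom.norm_apply_le hφ.toHom a

/-- Applied entrywise, `φ` is a `⋆`-homomorphism of matrix C⋆-algebras, hence contractive. The
entrywise inclusion of `A` in `B(E)` is injective, hence isometric, so norms over `A` and over
`B(E)` agree. -/
theorem IsStarHom.cbNormLE_one {φ : A.toStarSubalgebra →ₗ[ℂ] (E₁ →L[ℂ] E₁)}
    (hφ : IsStarHom φ) : CBNormLE φ 1 := by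
  intro n a
  have := isClosed_vonNeumannAlgebra A
  -- The C⋆-structure on matrices over `A` is built from an order on `A`; the spectral order
  -- supplies it.
  let _ : PartialOrder A.toStarSubalgebra := CStarAlgebra.spectralOrder _
  let _ : StarOrderedRing A.toStarSubalgebra := CStarAlgebra.spectralOrderedRing _
  have h1 := NonUnitalStarAlgHom.norm_apply_le (CStarMatrix.mapₙₐ (n := Fin n) hφ.toHom)
    (CStarMatrix.ofMatrix a)
  have h2 := NonUnitalStarAlgHom.norm_map
    (B := CStarMatrix (Fin n) (Fin n) (E →L[ℂ] E)) (CStarMatrix.mapₙₐ (n := Fin n)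
    (A.toStarSubalgebra.subtype : A.toStarSubalgebra →⋆ₙₐ[ℂ] (E →L[ℂ] E)))
    (fun M N h => CStarMatrix.ext fun i j => Subtype.ext (congrFun (congrFun h i) j))
    (CStarMatrix.ofMatrix a)
  rw [one_mul]
  exact h1.trans h2.symm.le

/-- The matrix factors as `diag(R⋆) M diag(S)`, and `T ↦ diag(T)` is a `⋆`-homomorphism, hence
contractive. -/
theorem norm_sandwich_matrix_le {n : ℕ} (R S : E₁ →L[ℂ] E₁)
    (M : Matrix (Fin n) (Fin n) (E₁ →L[ℂ] E₁)) :
    ‖CStarMatrix.ofMatrix (M.map fun T => star R * T * S)‖ ≤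
      ‖R‖ * ‖S‖ * ‖CStarMatrix.ofMatrix M‖ := by
  let ι : (E₁ →L[ℂ] E₁) →⋆ₙₐ[ℂ] CStarMatrix (Fin n) (Fin n) (E₁ →L[ℂ] E₁) :=
    { toFun := fun T => CStarMatrix.ofMatrix (Matrix.diagonal fun _ => T)
      map_smul' := fun c T => congrArg CStarMatrix.ofMatrix (Matrix.diagonal_smul c _)
      map_zero' := congrArg CStarMatrix.ofMatrix Matrix.diagonal_zero
      map_add' := fun T T' => congrArg CStarMatrix.ofMatrix (Matrix.diagonal_add _ _).symm
      map_mul' := fun T T' => congrArg CStarMatrix.ofMatrix (Matrix.diagonal_mul_diagonal _ _).symm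
      map_star' := fun T => congrArg CStarMatrix.ofMatrix (Matrix.diagonal_conjTranspose _).symm }
  have hle := NonUnitalStarAlgHom.norm_apply_le ι
  have : CStarMatrix.ofMatrix (M.map fun T => star R * T * S) =
      ι (star R) * CStarMatrix.ofMatrix M * ι S := by
    have h : M.map (fun T => star R * T * S) =
        Matrix.diagonal (fun _ => star R) * M * Matrix.diagonal (fun _ => S) :=
      Matrix.ext fun i j => by
        rw [Matrix.mul_diagonal, Matrix.diagonal_mul]
        rfl
    exact congrArg CStarMatrix.ofMatrix h
  rw [this]
  calc _ ≤ ‖ι (star R)‖ * ‖CStarMatrix.ofMatrix M‖ * ‖ι S‖ :=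
        (norm_mul_le _ _).trans (by gcongr; exact norm_mul_le _ _)
    _ ≤ ‖R‖ * ‖CStarMatrix.ofMatrix M‖ * ‖S‖ := by
        gcongr
        · exact (hle _).trans_eq (norm_star R)
        · exact hle _
    _ = _ := by ring

theorem IsStarHom.cbNormLE_sandwich {φ : A.toStarSubalgebra →ₗ[ℂ] (E₁ →L[ℂ] E₁)}
    (hφ : IsStarHom φ) (R S : E₁ →L[ℂ] E₁) : CBNormLE (sandwich φ R S) (‖R‖ * ‖S‖) := by
  intro n a
  have h := norm_sandwich_matrix_le R S (a.map fun x => φ x)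
  rw [Matrix.map_map] at h
  refine h.trans ?_
  gcongr
  exact (hφ.cbNormLE_one n a).trans_eq (one_mul _)

end CompletelyBounded

/-! ### The ultraweak topology and normal maps -/

section Ultraweak

variable {E : Type*} [NormedAddCommGroup E] [InnerProductSpace ℂ E]
  {E₁ : Type*} [NormedAddCommGroup E₁] [InnerProductSpace ℂ E₁]

/-- The sequence `(X (u n))` for a square-summable sequence `u`. -/
def lpMap (X : E →L[ℂ] E₁) (u : lp (fun _ : ℕ => E) 2) : lp (fun _ : ℕ => E₁) 2 :=
  ⟨fun n => X (u n), by
    have h := lp.memℓp u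
    change Memℓp _ _
    rw [memℓp_gen_iff (by norm_num)] at h ⊢
    refine (h.mul_left (‖X‖ ^ 2)).of_nonneg_of_le (fun n => by positivity) fun n => ?_
    simp only [ENNReal.toReal_ofNat, Real.rpow_ofNat, ← mul_pow]
    gcongr
    exact X.le_opNorm _⟩

theorem summable_norm_mul_norm {E E₁ : Type*} [NormedAddCommGroup E] [NormedAddCommGroup E₁]
    (u : lp (fun _ : ℕ => E) 2) (v : lp (fun _ : ℕ => E₁) 2) :
    Summable fun n => ‖u n‖ * ‖v n‖ := by
  have hu := lp.memℓp u
  have hv := lp.memℓp v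
  rw [memℓp_gen_iff (by norm_num)] at hu hv
  simp only [ENNReal.toReal_ofNat, Real.rpow_ofNat] at hu hv
  refine (hu.add hv).of_nonneg_of_le (fun n => by positivity) fun n => ?_
  nlinarith [sq_nonneg (‖u n‖ - ‖v n‖), sq_nonneg (‖u n‖ + ‖v n‖)]

theorem continuous_ultraweak_iff {α : Type*} {t : TopologicalSpace α} {f : α → E →L[ℂ] E} :
    @Continuous _ _ t (ultraweak E) f ↔ ∀ u v : lp (fun _ : ℕ => E) 2,
      Continuous fun x => ∑' n, ⟪u n, f x (v n)⟫_ℂ := by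
  simp only [continuous_iInf_rng, continuous_induced_rng]
  rfl

theorem continuous_functional_ultraweak (u v : lp (fun _ : ℕ => E) 2) :
    @Continuous _ _ (ultraweak E) _ fun T : E →L[ℂ] E => ∑' n, ⟪u n, T (v n)⟫_ℂ :=
  continuous_ultraweak_iff.1 (@continuous_id _ (ultraweak E)) u v

theorem continuous_inner_ultraweak (x y : E) :
    @Continuous _ _ (ultraweak E) _ fun T : E →L[ℂ] E => ⟪x, T y⟫_ℂ := by
  have h := continuous_functional_ultraweak (lp.single 2 0 x) (lp.single 2 0 y)
  convert h using 2 with T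
  rw [tsum_eq_single 0 fun n hn => by simp [hn]]
  simp

/-- On bounded families weak operator convergence implies ultraweak convergence: the series is
dominated by `C ‖u n‖ ‖v n‖`. -/
theorem tendsto_tsum_inner {α : Type*} {l : Filter α} {S : α → E →L[ℂ] E} {T : E →L[ℂ] E} {C : ℝ}
    (hC : ∀ᶠ i in l, ‖S i‖ ≤ C)
    (h : ∀ x y, Tendsto (fun i => ⟪x, S i y⟫_ℂ) l (𝓝 ⟪x, T y⟫_ℂ)) (u v : lp (fun _ : ℕ => E) 2) :
    Tendsto (fun i => ∑' n, ⟪u n, S i (v n)⟫_ℂ) l (𝓝 (∑' n, ⟪u n, T (v n)⟫_ℂ)) := by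
  refine tendsto_tsum_of_dominated_convergence ((summable_norm_mul_norm u v).mul_left C)
    (fun n => h _ _) ?_
  filter_upwards [hC] with i hi n
  calc _ ≤ ‖u n‖ * ‖S i (v n)‖ := norm_inner_le_norm _ _
    _ ≤ ‖u n‖ * (C * ‖v n‖) := by gcongr; exact (S i).le_of_opNorm_le hi _
    _ = _ := by ring

variable [CompleteSpace E] [CompleteSpace E₁] {A : VonNeumannAlgebra E}

/-- The functional given by `(u, v)`, evaluated at `X φ(a) Y`, is the one given by `(X⋆ u, Y v)`,
evaluated at `φ(a)`. -/
theorem IsNormal.comp {φ : A.toStarSubalgebra →ₗ[ℂ] (E₁ →L[ℂ] E₁)} (hφ : IsNormal φ)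
    {E₂ : Type*} [NormedAddCommGroup E₂] [InnerProductSpace ℂ E₂] [CompleteSpace E₂]
    (X : E₁ →L[ℂ] E₂) (Y : E₂ →L[ℂ] E₁) {φ' : A.toStarSubalgebra →ₗ[ℂ] (E₂ →L[ℂ] E₂)}
    (h : ∀ a, φ' a = X ∘L φ a ∘L Y) : IsNormal φ' := by
  refine continuous_ultraweak_iff.2 fun u v => ?_
  have h1 := continuous_ultraweak_iff.1 hφ (lpMap (ContinuousLinearMap.adjoint X) u) (lpMap Y v)
  convert h1 using 4 with a n
  rw [h]
  exact (ContinuousLinearMap.adjoint_inner_left X _ _).symm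

theorem IsNormal.tendsto_inner {φ : A.toStarSubalgebra →ₗ[ℂ] (E₁ →L[ℂ] E₁)} (hφ : IsNormal φ)
    {α : Type*} {l : Filter α} {f : α → A.toStarSubalgebra} {a : A.toStarSubalgebra} {C : ℝ}
    (hC : ∀ i, ‖(f i : E →L[ℂ] E)‖ ≤ C)
    (h : ∀ x y, Tendsto (fun i => ⟪x, (f i : E →L[ℂ] E) y⟫_ℂ) l (𝓝 ⟪x, (a : E →L[ℂ] E) y⟫_ℂ))
    (x y : E₁) : Tendsto (fun i => ⟪x, φ (f i) y⟫_ℂ) l (𝓝 ⟪x, φ a y⟫_ℂ) := by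
  have h1 : Tendsto f l (@nhds _ ((ultraweak E).induced Subtype.val) a) := by
    rw [@nhds_induced _ _ (ultraweak E) Subtype.val a, tendsto_comap_iff, nhds_iInf, tendsto_iInf]
    intro u
    rw [nhds_iInf, tendsto_iInf]
    intro v
    rw [nhds_induced, tendsto_comap_iff]
    exact tendsto_tsum_inner (Eventually.of_forall hC) h u v
  have h2 := @Continuous.comp _ _ _ ((ultraweak E).induced Subtype.val) (ultraweak E₁) _ _ _
    (continuous_inner_ultraweak x y) hφ
  exact (@Continuous.tendsto _ _ ((ultraweak E).induced Subtype.val) _ _ h2 a).comp h1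

end Ultraweak

/-! ### Weak compactness of balls of operators -/

section WeakLimit

variable {E : Type*} [NormedAddCommGroup E] [InnerProductSpace ℂ E] [CompleteSpace E]

/-- Each matrix element stays in a compact disc and so converges along the ultrafilter. By
uniqueness of limits these values form a bounded sesquilinear form, which an operator represents. -/
theorem exists_weak_limit {α : Type*} (l : Ultrafilter α) {S : α → E →L[ℂ] E} {C : ℝ}
    (hC0 : 0 ≤ C) (hC : ∀ i, ‖S i‖ ≤ C) : ∃ T : E →L[ℂ] E, ‖T‖ ≤ C ∧
      ∀ x y, Tendsto (fun i => ⟪x, S i y⟫_ℂ) l (𝓝 ⟪x, T y⟫_ℂ) := by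
  have hb : ∀ x y i, ‖⟪x, S i y⟫_ℂ‖ ≤ C * ‖x‖ * ‖y‖ := fun x y i => by
    calc _ ≤ ‖x‖ * ‖S i y‖ := norm_inner_le_norm _ _
      _ ≤ ‖x‖ * (C * ‖y‖) := by gcongr; exact (S i).le_of_opNorm_le (hC i) _
      _ = _ := by ring
  have hex : ∀ x y, ∃ c : ℂ, ‖c‖ ≤ C * ‖x‖ * ‖y‖ ∧ Tendsto (fun i => ⟪x, S i y⟫_ℂ) l (𝓝 c) := by
    intro x y
    obtain ⟨c, hc, h⟩ := (isCompact_closedBall (0 : ℂ) (C * ‖x‖ * ‖y‖)).ultrafilter_le_nhds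
      (l.map fun i => ⟪x, S i y⟫_ℂ) (by
        rw [Ultrafilter.coe_map, Filter.le_principal_iff, Filter.mem_map]
        exact Filter.univ_mem' fun i => mem_closedBall_zero_iff.2 (hb x y i))
    exact ⟨c, mem_closedBall_zero_iff.1 hc, h⟩
  choose B hB hlim using hex
  let B' : E →L⋆[ℂ] E →L[ℂ] ℂ := LinearMap.mkContinuous₂
    (LinearMap.mk₂'ₛₗ (starRingEnd ℂ) (RingHom.id ℂ) B
      (fun x x' y => tendsto_nhds_unique (hlim _ _)
        (((hlim x y).add (hlim x' y)).congr fun i => (inner_add_left _ _ _).symm))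
      (fun c x y => tendsto_nhds_unique (hlim _ _)
        (((hlim x y).const_mul _).congr fun i => (inner_smul_left _ _ _).symm))
      (fun x y y' => tendsto_nhds_unique (hlim _ _)
        (((hlim x y).add (hlim x y')).congr fun i => by rw [map_add, inner_add_right]))
      (fun c x y => tendsto_nhds_unique (hlim _ _)
        (((hlim x y).const_mul c).congr fun i => by rw [map_smul, inner_smul_right])))
    C hB
  have hT : ∀ x y, ⟪x, ContinuousLinearMap.adjoint
      (InnerProductSpace.continuousLinearMapOfBilin B') y⟫_ℂ = B x y := fun x y => by
    rw [ContinuousLinearMap.adjoint_inner_right,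
      InnerProductSpace.continuousLinearMapOfBilin_apply]
    rfl
  refine ⟨_, ContinuousLinearMap.opNorm_le_bound _ hC0 fun y => ?_, fun x y => by
    rw [hT]; exact hlim x y⟩
  set z := ContinuousLinearMap.adjoint (InnerProductSpace.continuousLinearMapOfBilin B') y with hz
  rcases (norm_nonneg z).eq_or_lt with h | h
  · rw [← h]; positivity
  refine le_of_mul_le_mul_left ?_ h
  rw [← inner_self_eq_norm_mul_norm (𝕜 := ℂ)]
  refine (RCLike.re_le_norm _).trans ?_
  nth_rw 2 [hz]
  rw [hT]
  exact (hB z y).trans_eq (by ring)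

end WeakLimit

/-! ### Slices and the von Neumann algebra tensor product -/

section Slices

variable {E : Type*} [NormedAddCommGroup E] [InnerProductSpace ℂ E]
  {G : Type*} [NormedAddCommGroup G] [InnerProductSpace ℂ G]

variable (E) in
/-- The map `ψ ↦ E_ψ`. -/
def ketL : G →L[ℂ] E →L[ℂ] HTensor E G :=
  ContinuousLinearMap.compL ℂ E (E ⊗[ℂ] G) (HTensor E G) (incl E G).toContinuousLinearMap ∘L
    (TensorProduct.mkL ℂ E G).flip

theorem ketL_apply (ψ : G) : ketL E ψ = ket ψ := rfl

theorem tmul_smul (u : E) (c : ℂ) (ψ : G) : tmul u (c • ψ) = c • tmul u ψ := by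
  rw [tmul, TensorProduct.tmul_smul, map_smul]; rfl

theorem opTensor_comp {E' E'' G' G'' : Type*}
    [NormedAddCommGroup E'] [InnerProductSpace ℂ E'] [NormedAddCommGroup E'']
    [InnerProductSpace ℂ E''] [NormedAddCommGroup G'] [InnerProductSpace ℂ G']
    [NormedAddCommGroup G''] [InnerProductSpace ℂ G''] (S : E' →L[ℂ] E'') (S' : E →L[ℂ] E')
    (T : G' →L[ℂ] G'') (T' : G →L[ℂ] G') :
    opTensor S T ∘L opTensor S' T' = opTensor (S ∘L S') (T ∘L T') :=
  ext_tmul fun u ψ => by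
    rw [ContinuousLinearMap.comp_apply, opTensor_tmul, opTensor_tmul, opTensor_tmul]; rfl

theorem inner_ext_total {F F' : Type*} [NormedAddCommGroup F] [InnerProductSpace ℂ F]
    [CompleteSpace F] [NormedAddCommGroup F'] [InnerProductSpace ℂ F'] {ι κ : Type*}
    {x : ι → F} {y : κ → F'} (hx : IsTotal x) (hy : IsTotal y) {S T : F →L[ℂ] F'}
    (h : ∀ i j, ⟪y j, S (x i)⟫_ℂ = ⟪y j, T (x i)⟫_ℂ) : S = T := by
  have h1 : ∀ i, S (x i) = T (x i) := fun i => sub_eq_zero.1 (hy _ fun j => by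
    rw [inner_sub_right, h, sub_self])
  refine ContinuousLinearMap.ext fun z => ?_
  refine hx.denseRange.induction_on z (isClosed_eq S.continuous T.continuous) fun a => ?_
  simp only [Finsupp.linearCombination_apply, Finsupp.sum, map_sum, map_smul, h1]

variable [CompleteSpace E]

theorem star_opTensor [CompleteSpace G] (S : E →L[ℂ] E) (T : G →L[ℂ] G) :
    star (opTensor S T) = opTensor (star S) (star T) :=
  inner_ext_total isTotal_tmul isTotal_tmul fun p q => by
    simp only [ContinuousLinearMap.star_eq_adjoint, ContinuousLinearMap.adjoint_inner_right,
      opTensor_tmul, inner_tmul]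

theorem continuous_slice (T : HTensor E G →L[ℂ] HTensor E G) :
    Continuous fun p : G × G => slice p.1 p.2 T := by
  have h1 : Continuous fun p : G × G => (bra p.1 : HTensor E G →L[ℂ] E) :=
    (ContinuousLinearMap.adjoint (𝕜 := ℂ) (E := E) (F := HTensor E G)).continuous.comp
      ((ketL E).continuous.comp continuous_fst)
  have h2 : Continuous fun p : G × G => T ∘L ket (E := E) p.2 :=
    continuous_const.clm_comp ((ketL E).continuous.comp continuous_snd)
  exact h1.clm_comp h2

theorem slice_sum_smul {ι : Type*} (s : Finset ι) (c d : ι → ℂ) (e : ι → G)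
    (T : HTensor E G →L[ℂ] HTensor E G) :
    slice (∑ i ∈ s, c i • e i) (∑ i ∈ s, d i • e i) T =
      ∑ i ∈ s, ∑ j ∈ s, (starRingEnd ℂ (c i) * d j) • slice (e i) (e j) T := by
  have h : ∀ c : ι → ℂ, ket (E := E) (∑ i ∈ s, c i • e i) = ∑ i ∈ s, c i • ket (e i) := fun c => by
    simp only [← ketL_apply, map_sum, map_smul]
  simp only [slice, bra, h, map_sum, map_smulₛₗ, ContinuousLinearMap.comp_finsetSum,
    ContinuousLinearMap.finsetSum_comp, ContinuousLinearMap.comp_smul,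
    ContinuousLinearMap.smul_comp]
  rw [Finset.sum_comm]
  simp only [Finset.smul_sum, smul_smul, mul_comm]

theorem slice_star (ψ χ : G) (T : HTensor E G →L[ℂ] HTensor E G) :
    slice ψ χ (star T) = star (slice χ ψ T) := by
  refine ContinuousLinearMap.ext fun w => ext_inner_left ℂ fun u => ?_
  rw [inner_slice, ContinuousLinearMap.star_eq_adjoint, ContinuousLinearMap.star_eq_adjoint,
    ContinuousLinearMap.adjoint_inner_right, ContinuousLinearMap.adjoint_inner_right,
    ← inner_conj_symm, ← inner_slice, inner_conj_symm]

theorem slice_opTensor_mul (c : E →L[ℂ] E) (ψ χ : G) (T : HTensor E G →L[ℂ] HTensor E G) :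
    slice ψ χ (opTensor c (ContinuousLinearMap.id ℂ G) * T) = c * slice ψ χ T := by
  refine ContinuousLinearMap.ext fun w => ext_inner_left ℂ fun u => ?_
  rw [inner_slice]
  change ⟪tmul u ψ, opTensor c (ContinuousLinearMap.id ℂ G) (T (tmul w χ))⟫_ℂ =
    ⟪u, c (slice ψ χ T w)⟫_ℂ
  rw [← ContinuousLinearMap.adjoint_inner_left c, inner_slice]
  have : ∀ z, ⟪tmul u ψ, opTensor c (ContinuousLinearMap.id ℂ G) z⟫_ℂ =
      ⟪tmul (ContinuousLinearMap.adjoint c u) ψ, z⟫_ℂ := fun z => by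
    have : innerSL ℂ (tmul u ψ) ∘L opTensor c (ContinuousLinearMap.id ℂ G) =
        innerSL ℂ (tmul (ContinuousLinearMap.adjoint c u) ψ) := ext_tmul fun v φ => by
      change ⟪tmul u ψ, opTensor c (ContinuousLinearMap.id ℂ G) (tmul v φ)⟫_ℂ =
        ⟪tmul (ContinuousLinearMap.adjoint c u) ψ, tmul v φ⟫_ℂ
      rw [opTensor_tmul, inner_tmul, inner_tmul, ContinuousLinearMap.adjoint_inner_left]
      rfl
    exact congrArg (fun L => L z) this
  exact this _

theorem slice_mul_opTensor (c : E →L[ℂ] E) (ψ χ : G) (T : HTensor E G →L[ℂ] HTensor E G) :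
    slice ψ χ (T * opTensor c (ContinuousLinearMap.id ℂ G)) = slice ψ χ T * c := by
  refine ContinuousLinearMap.ext fun w => ?_
  change bra ψ (T (opTensor c _ (ket χ w))) = bra ψ (T (ket χ (c w)))
  rw [ket_apply, opTensor_tmul]
  rfl

variable (G) in
/-- The von Neumann algebra tensor product of `A` and `B(G)`. -/
def tensorAlg (A : VonNeumannAlgebra E) : Set (HTensor E G →L[ℂ] HTensor E G) :=
  {T | ∀ ψ χ, slice ψ χ T ∈ A.toStarSubalgebra}

/-- By the double commutant theorem, lying in `A` means commuting with `A'`; and `c ⊗ I` passes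
through slices. -/
theorem slice_mem_iff (A : VonNeumannAlgebra E) (ψ χ : G) (T : HTensor E G →L[ℂ] HTensor E G) :
    slice ψ χ T ∈ A.toStarSubalgebra ↔ ∀ c ∈ A.commutant,
      slice ψ χ (opTensor c (ContinuousLinearMap.id ℂ G) * T) =
        slice ψ χ (T * opTensor c (ContinuousLinearMap.id ℂ G)) := by
  have : slice ψ χ T ∈ A.toStarSubalgebra ↔ slice ψ χ T ∈ A.commutant.commutant := by
    rw [A.commutant_commutant]; rfl
  simp only [this, VonNeumannAlgebra.mem_commutant_iff (S := A.commutant), slice_opTensor_mul,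
    slice_mul_opTensor]

/-- Slices separate operators, so the slice conditions together say that `T` is in the commutant of
`A' ⊗ I`. This form makes closure under products evident. -/
theorem mem_tensorAlg_iff (A : VonNeumannAlgebra E) (T : HTensor E G →L[ℂ] HTensor E G) :
    T ∈ tensorAlg G A ↔ ∀ c ∈ A.commutant,
      Commute (opTensor c (ContinuousLinearMap.id ℂ G)) T := by
  simp only [tensorAlg, Set.mem_ofPred_eq, slice_mem_iff]
  exact ⟨fun h c hc => slice_ext fun ψ χ => h ψ χ c hc, fun h ψ χ c hc => by rw [(h c hc).eq]⟩

/-- Commutation with `c ⊗ I` can be tested on matrix elements between total vectors. Thus slices at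
step functions control all slices. -/
theorem mem_tensorAlg_of_total [CompleteSpace G] {A : VonNeumannAlgebra E}
    {T : HTensor E G →L[ℂ] HTensor E G} {ι : Type*} {x : ι → G} (hx : IsTotal x)
    (h : ∀ i j, slice (x i) (x j) T ∈ A.toStarSubalgebra) : T ∈ tensorAlg G A := by
  refine (mem_tensorAlg_iff A T).2 fun c hc => ?_
  have ht := IsTotal.tmul (x := fun u : E => u) (fun z hz => inner_self_eq_zero.1 (hz z)) hx
  refine inner_ext_total ht ht fun p q => ?_
  rw [← inner_slice, ← inner_slice, (slice_mem_iff A _ _ T).1 (h _ _) c hc]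

theorem mul_mem_tensorAlg {A : VonNeumannAlgebra E} {S T : HTensor E G →L[ℂ] HTensor E G}
    (hS : S ∈ tensorAlg G A) (hT : T ∈ tensorAlg G A) : S * T ∈ tensorAlg G A := by
  rw [mem_tensorAlg_iff] at *
  exact fun c hc => (hS c hc).mul_right (hT c hc)

theorem star_mem_tensorAlg {A : VonNeumannAlgebra E} {T : HTensor E G →L[ℂ] HTensor E G}
    (hT : T ∈ tensorAlg G A) : star T ∈ tensorAlg G A := fun ψ χ => by
  rw [slice_star]; exact A.toStarSubalgebra.star_mem' (hT χ ψ)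

end Slices

/-! ### Finite-rank approximation in the second tensor factor -/

section Approximation

universe u

variable (G : Type u) [NormedAddCommGroup G] [InnerProductSpace ℂ G]

/-- A net of finite orthonormal families whose projections tend strongly to the identity. -/
theorem exists_orthonormal_net [CompleteSpace G] : ∃ (α : Type u) (l : Ultrafilter α) (n : α → ℕ)
    (e : ∀ i, Fin (n i) → G), (∀ i, Orthonormal ℂ (e i)) ∧
      ∀ ψ, Tendsto (fun i => ∑ k, ⟪e i k, ψ⟫_ℂ • e i k) l (𝓝 ψ) := by
  obtain ⟨w, b, -⟩ := exists_hilbertBasis ℂ G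
  refine ⟨Finset w, Ultrafilter.of atTop, fun s => s.card, fun s k => b (s.equivFin.symm k),
    fun s => b.orthonormal.comp _ (Subtype.val_injective.comp s.equivFin.symm.injective),
    fun ψ => ?_⟩
  -- Refining the net of finite subsets of an orthonormal basis to an ultrafilter keeps the
  -- convergence and makes `exists_weak_limit` applicable.
  have h := (b.hasSum_repr ψ).mono_left (Ultrafilter.of_le atTop)
  refine h.congr fun s => ?_
  rw [← Finset.sum_coe_sort, ← s.equivFin.symm.sum_comp]
  simp [HilbertBasis.repr_apply_apply]

variable {G} {E : Type*} [NormedAddCommGroup E] [InnerProductSpace ℂ E] [CompleteSpace E]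
  {n : ℕ} {e : Fin n → G}

/-- This map is the adjoint of the isometry `w ↦ ∑ w_k ⊗ e_k`. -/
theorem norm_bra_family_le (he : Orthonormal ℂ e) (z : HTensor E G) :
    ‖(WithLp.toLp 2 fun k => bra (e k) z : PiLp 2 fun _ : Fin n => E)‖ ≤ ‖z‖ := by
  set w : PiLp 2 fun _ : Fin n => E := WithLp.toLp 2 fun k => bra (e k) z with hw
  have h : ⟪w, w⟫_ℂ = ⟪∑ k, tmul (w k) (e k), z⟫_ℂ := by
    rw [PiLp.inner_apply, sum_inner]
    refine Finset.sum_congr rfl fun k _ => ?_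
    exact ContinuousLinearMap.adjoint_inner_right (ket (e k)) (w k) z
  rcases (norm_nonneg w).eq_or_lt with h0 | h0
  · rw [← h0]; positivity
  refine le_of_mul_le_mul_left ?_ h0
  rw [← inner_self_eq_norm_mul_norm (𝕜 := ℂ), h]
  refine (RCLike.re_le_norm _).trans ((norm_inner_le_norm _ _).trans_eq ?_)
  rw [norm_sum_tmul he]

/-- The operator `1 ⊗ P`, where `P` is the orthogonal projection on the span of the `e k`. -/
def ampProj (E : Type*) [NormedAddCommGroup E] [InnerProductSpace ℂ E] [CompleteSpace E]
    (e : Fin n → G) : HTensor E G →L[ℂ] HTensor E G := ∑ k, ket (e k) ∘L bra (e k)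

theorem norm_ampProj_le (he : Orthonormal ℂ e) : ‖ampProj E e‖ ≤ 1 := by
  refine ContinuousLinearMap.opNorm_le_bound _ zero_le_one fun z => ?_
  have : ampProj E e z = ∑ k, tmul ((WithLp.toLp 2 fun k => bra (e k) z :
      PiLp 2 fun _ : Fin n => E) k) (e k) := by simp [ampProj, ket_apply]
  rw [this, norm_sum_tmul he, one_mul]
  exact norm_bra_family_le he z

theorem tendsto_ampProj {α : Type*} {l : Filter α} {n : α → ℕ} {e : ∀ i, Fin (n i) → G}
    (he : ∀ i, Orthonormal ℂ (e i))
    (hl : ∀ ψ, Tendsto (fun i => ∑ k, ⟪e i k, ψ⟫_ℂ • e i k) l (𝓝 ψ)) (z : HTensor E G) :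
    Tendsto (fun i => ampProj E (e i) z) l (𝓝 z) := by
  -- Contractions are uniformly equicontinuous, so convergence holds on a closed set and need only
  -- be checked on algebraic tensors.
  have heq : UniformEquicontinuous fun i => (ampProj E (e i) : HTensor E G → HTensor E G) :=
    LipschitzWith.uniformEquicontinuous _ 1 fun i =>
      (ampProj E (e i)).lipschitz.weaken (norm_ampProj_le (he i))
  have hcl := heq.equicontinuous.isClosed_setOfPred_tendsto (l := l) continuous_id
  refine (denseRange_incl E G).induction_on (p := fun z =>
    Tendsto (fun i => ampProj E (e i) z) l (𝓝 z)) z hcl fun x => ?_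
  induction x using TensorProduct.induction_on with
  | zero => simp only [map_zero]; exact tendsto_const_nhds
  | add x y hx hy => simp only [map_add]; exact hx.add hy
  | tmul u ψ =>
    change Tendsto _ _ (𝓝 (ket ψ u))
    have h : Continuous fun χ : G => ket (E := E) χ u :=
      (ContinuousLinearMap.apply ℂ (HTensor E G) u ∘L ketL E).continuous
    refine ((h.tendsto ψ).comp (hl ψ)).congr fun i => ?_
    change ketL E (∑ k, ⟪e i k, ψ⟫_ℂ • e i k) u = ampProj E (e i) (tmul u ψ)
    simp only [map_sum, map_smul, sum_apply, ampProj, ContinuousLinearMap.comp_apply, bra_tmul,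
      ketL_apply, smul_apply]

end Approximation

/-! ### The map `φ ⊗ id` for a `⋆`-homomorphism `φ` -/

section TensorId

universe w

variable {E : Type*} [NormedAddCommGroup E] [InnerProductSpace ℂ E] [CompleteSpace E]
  {E₁ : Type*} [NormedAddCommGroup E₁] [InnerProductSpace ℂ E₁] [CompleteSpace E₁]
  {G : Type w} [NormedAddCommGroup G] [InnerProductSpace ℂ G]
  {A : VonNeumannAlgebra E} {φ : A.toStarSubalgebra →ₗ[ℂ] (E₁ →L[ℂ] E₁)}
  {S T : HTensor E G →L[ℂ] HTensor E G}

/-- The compression of `(φ ⊗ id) T` to the span of the vectors `e k`. -/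
def compression (φ : A.toStarSubalgebra →ₗ[ℂ] (E₁ →L[ℂ] E₁)) (hT : T ∈ tensorAlg G A) {n : ℕ}
    (e : Fin n → G) : HTensor E₁ G →L[ℂ] HTensor E₁ G :=
  ∑ i, ∑ j, ket (e i) ∘L φ ⟨slice (e i) (e j) T, hT _ _⟩ ∘L bra (e j)

theorem inner_compression (hT : T ∈ tensorAlg G A) {n : ℕ} (e : Fin n → G) (x y : HTensor E₁ G) :
    ⟪x, compression φ hT e y⟫_ℂ =
      ∑ i, ∑ j, ⟪bra (e i) x, φ ⟨slice (e i) (e j) T, hT _ _⟩ (bra (e j) y)⟫_ℂ := by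
  simp only [compression, sum_apply, inner_sum, ContinuousLinearMap.comp_apply, bra,
    ContinuousLinearMap.adjoint_inner_left]

/-- The compression is `V M V⋆`, with `V` isometric and `M` the matrix of the `φ`-images of slices.
Complete contractivity and `norm_slice_matrix_le` give `‖M‖ ≤ ‖T‖`. -/
theorem norm_compression_le (hφ : IsStarHom φ) (hT : T ∈ tensorAlg G A) {n : ℕ} {e : Fin n → G}
    (he : Orthonormal ℂ e) : ‖compression φ hT e‖ ≤ ‖T‖ := by
  have hM : ‖CStarMatrix.ofMatrix fun i j => φ ⟨slice (e i) (e j) T, hT _ _⟩‖ ≤ ‖T‖ := by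
    refine (hφ.cbNormLE_one n fun i j => ⟨slice (e i) (e j) T, hT _ _⟩).trans ?_
    rw [one_mul]
    exact norm_slice_matrix_le he T
  refine ContinuousLinearMap.opNorm_le_bound _ (norm_nonneg _) fun y => ?_
  set z := compression φ hT e y with hz
  rcases (norm_nonneg z).eq_or_lt with h | h
  · rw [← h]; positivity
  refine le_of_mul_le_mul_left ?_ h
  rw [← inner_self_eq_norm_mul_norm (𝕜 := ℂ)]
  refine (RCLike.re_le_norm _).trans ?_
  nth_rw 2 [hz]
  rw [inner_compression]
  calc _ ≤ _ := norm_sum_inner_le _ (WithLp.toLp 2 fun k => bra (e k) z)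
        (WithLp.toLp 2 fun k => bra (e k) y)
    _ ≤ ‖T‖ * ‖z‖ * ‖y‖ := by
        gcongr
        · exact hM
        · exact norm_bra_family_le he z
        · exact norm_bra_family_le he y
    _ = _ := by ring

theorem slice_compression (hT : T ∈ tensorAlg G A) {n : ℕ} (e : Fin n → G) (ψ χ : G) :
    slice ψ χ (compression φ hT e) =
      φ ⟨slice (∑ k, ⟪e k, ψ⟫_ℂ • e k) (∑ k, ⟪e k, χ⟫_ℂ • e k) T, hT _ _⟩ := by
  have h : (⟨slice (∑ k, ⟪e k, ψ⟫_ℂ • e k) (∑ k, ⟪e k, χ⟫_ℂ • e k) T, hT _ _⟩ :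
      A.toStarSubalgebra) = ∑ i, ∑ j, (starRingEnd ℂ ⟪e i, ψ⟫_ℂ * ⟪e j, χ⟫_ℂ) •
        (⟨slice (e i) (e j) T, hT _ _⟩ : A.toStarSubalgebra) := by
    refine Subtype.ext ((slice_sum_smul _ _ _ _ _).trans ?_)
    simp
  rw [h]
  refine ContinuousLinearMap.ext fun w => ext_inner_left ℂ fun u => ?_
  rw [inner_slice, inner_compression]
  simp only [bra_tmul, map_sum, map_smul, sum_apply, smul_apply, inner_sum, inner_smul_left,
    inner_smul_right, mul_assoc]
  simp only [mul_left_comm]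

theorem IsStarHom.continuous (hφ : IsStarHom φ) : Continuous φ :=
  AddMonoidHomClass.continuous_of_bound φ 1 fun a => (hφ.norm_le a).trans_eq (one_mul _).symm

theorem continuous_map_slice (hφ : IsStarHom φ) (hT : T ∈ tensorAlg G A) :
    Continuous fun p : G × G => φ ⟨slice p.1 p.2 T, hT _ _⟩ :=
  hφ.continuous.comp ((continuous_slice T).subtype_mk _)

/-- Slicing the compression at `ψ, χ` amounts to slicing `T` at their projections, which tend to `ψ,
χ` in norm. Norm continuity of `φ` is enough here. -/
theorem tendsto_slice_compression (hφ : IsStarHom φ) (hT : T ∈ tensorAlg G A)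
    {α : Type*} {l : Filter α} {n : α → ℕ} {e : ∀ i, Fin (n i) → G}
    (hl : ∀ ψ, Tendsto (fun i => ∑ k, ⟪e i k, ψ⟫_ℂ • e i k) l (𝓝 ψ)) (ψ χ : G) :
    Tendsto (fun i => slice ψ χ (compression φ hT (e i))) l
      (𝓝 (φ ⟨slice ψ χ T, hT _ _⟩)) := by
  have h1 : Tendsto (fun p : G × G => φ ⟨slice p.1 p.2 T, hT _ _⟩) (𝓝 (ψ, χ))
      (𝓝 (φ ⟨slice ψ χ T, hT _ _⟩)) := (continuous_map_slice hφ hT).tendsto (ψ, χ)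
  have h2 : Tendsto (fun i => (∑ k, ⟪e i k, ψ⟫_ℂ • e i k, ∑ k, ⟪e i k, χ⟫_ℂ • e i k)) l
      (𝓝 (ψ, χ)) := (hl ψ).prodMk_nhds (hl χ)
  exact (h1.comp h2).congr fun i => (slice_compression hT (e i) ψ χ).symm

/-- A weak limit of the bounded compressions has the required slices. This excludes the default
value `0` of `tensorId` and yields its norm bound. -/
theorem exists_isTensorId [CompleteSpace G] (hφ : IsStarHom φ) (hT : T ∈ tensorAlg G A) :
    ∃ S, IsTensorId φ T S ∧ ‖S‖ ≤ ‖T‖ := by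
  obtain ⟨α, l, n, e, he, hl⟩ := exists_orthonormal_net G
  obtain ⟨S, hS, hlim⟩ := exists_weak_limit l (norm_nonneg T)
    fun i => norm_compression_le hφ hT (he i)
  refine ⟨S, fun ψ χ => ⟨hT ψ χ, ?_⟩, hS⟩
  refine ContinuousLinearMap.ext fun w => ext_inner_left ℂ fun u => ?_
  rw [inner_slice]
  refine tendsto_nhds_unique (hlim _ _) ?_
  simp only [← inner_slice]
  exact tendsto_const_nhds.inner
    (((ContinuousLinearMap.apply ℂ E₁ w).continuous.tendsto _).comp
      (tendsto_slice_compression hφ hT hl ψ χ))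

theorem isTensorId_tensorId [CompleteSpace G] (hφ : IsStarHom φ) (hT : T ∈ tensorAlg G A) :
    IsTensorId φ T (tensorId φ T) := by
  obtain ⟨S, hS, -⟩ := exists_isTensorId hφ hT
  rwa [tensorId_eq hS]

theorem norm_tensorId_le [CompleteSpace G] (hφ : IsStarHom φ) (hT : T ∈ tensorAlg G A) :
    ‖tensorId φ T‖ ≤ ‖T‖ := by
  obtain ⟨S, hS, h⟩ := exists_isTensorId hφ hT
  rwa [tensorId_eq hS]

theorem tensorId_star [CompleteSpace G] (hφ : IsStarHom φ) (hT : T ∈ tensorAlg G A) :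
    tensorId φ (star T) = star (tensorId φ T) := by
  refine tensorId_eq fun ψ χ => ⟨star_mem_tensorAlg hT ψ χ, ?_⟩
  obtain ⟨h, h'⟩ := isTensorId_tensorId hφ hT χ ψ
  rw [slice_star, h', ← hφ.map_star]
  congr 1
  exact Subtype.ext (slice_star ψ χ T).symm

theorem slice_mul_ampProj_mul (ψ χ : G) {n : ℕ} (e : Fin n → G) :
    slice ψ χ (S * ampProj E e * T) = ∑ k, slice ψ (e k) S * slice (e k) χ T := by
  simp only [ampProj, slice, Finset.mul_sum, Finset.sum_mul, ContinuousLinearMap.comp_finsetSum,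
    ContinuousLinearMap.finsetSum_comp]
  rfl

theorem tendsto_inner_slice_mul {α : Type*} {l : Filter α} {n : α → ℕ} {e : ∀ i, Fin (n i) → G}
    (he : ∀ i, Orthonormal ℂ (e i))
    (hl : ∀ ψ, Tendsto (fun i => ∑ k, ⟪e i k, ψ⟫_ℂ • e i k) l (𝓝 ψ))
    {F : Type*} [NormedAddCommGroup F] [InnerProductSpace ℂ F] [CompleteSpace F]
    (P Q : HTensor F G →L[ℂ] HTensor F G) (ψ χ : G) (x y : F) :
    Tendsto (fun i => ⟪x, slice ψ χ (P * ampProj F (e i) * Q) y⟫_ℂ) l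
      (𝓝 ⟪x, slice ψ χ (P * Q) y⟫_ℂ) := by
  simp only [inner_slice]
  exact tendsto_const_nhds.inner
    ((P.continuous.tendsto _).comp (tendsto_ampProj he hl (Q (tmul y χ))))

/-- With `I ⊗ P` between the factors, a slice of the product is a finite sum of products of slices,
on which `φ` is multiplicative. As `P` increases to `I`, these elements of `A` are bounded but
converge only weakly, so passing to the limit under `φ` uses normality. -/
theorem tensorId_mul [CompleteSpace G] (hφ : IsStarHom φ) (hn : IsNormal φ)
    (hS : S ∈ tensorAlg G A) (hT : T ∈ tensorAlg G A) :
    tensorId φ (S * T) = tensorId φ S * tensorId φ T := by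
  refine tensorId_eq fun ψ χ => ⟨mul_mem_tensorAlg hS hT ψ χ, ?_⟩
  obtain ⟨α, l, n, e, he, hl⟩ := exists_orthonormal_net G
  have hS' := isTensorId_tensorId hφ hS
  have hT' := isTensorId_tensorId hφ hT
  refine ContinuousLinearMap.ext fun y => ext_inner_left ℂ fun x => ?_
  refine tendsto_nhds_unique (tendsto_inner_slice_mul he hl (tensorId φ S) (tensorId φ T) ψ χ x y) ?_
  let f : α → A.toStarSubalgebra := fun i =>
    ∑ k, (⟨slice ψ (e i k) S, hS _ _⟩ : A.toStarSubalgebra) * ⟨slice (e i k) χ T, hT _ _⟩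
  have hf : ∀ i, (f i : E →L[ℂ] E) = slice ψ χ (S * ampProj E (e i) * T) := fun i => by
    rw [slice_mul_ampProj_mul]
    simp [f]
  have hf' : ∀ i, φ (f i) = slice ψ χ (tensorId φ S * ampProj E₁ (e i) * tensorId φ T) :=
    fun i => by
      rw [slice_mul_ampProj_mul, map_sum]
      refine Finset.sum_congr rfl fun k _ => ?_
      rw [hφ.map_mul, (hS' _ _).choose_spec, (hT' _ _).choose_spec]
  simp only [← hf']
  refine hn.tendsto_inner (C := ‖(bra ψ : HTensor E G →L[ℂ] E)‖ *
    (‖S‖ * 1 * ‖T‖ * ‖(ket χ : E →L[ℂ] HTensor E G)‖)) (fun i => ?_) ?_ x y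
  · rw [hf]
    refine (ContinuousLinearMap.opNorm_comp_le _ _).trans ?_
    gcongr
    refine (ContinuousLinearMap.opNorm_comp_le _ _).trans ?_
    gcongr
    refine (norm_mul_le _ _).trans ?_
    gcongr
    refine (norm_mul_le _ _).trans ?_
    gcongr
    exact norm_ampProj_le (he i)
  · simp only [hf]
    exact tendsto_inner_slice_mul he hl S T ψ χ

end TensorId

/-! ### Totality of step functions and their exponential vectors -/

section StepFunctions

variable {K : Type*} [NormedAddCommGroup K] [InnerProductSpace ℂ K]

/-- The half-lines `]-∞, b[` form a π-system generating the Borel sets, and each meets `[0, N[` in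
an interval starting at `0`. -/
theorem setIntegral_eq_zero_of_Ico {z : ℝ → K} {N : ℝ} (hz : IntegrableOn z (Set.Ico 0 N))
    (h : ∀ b : ℝ, ∫ x in Set.Ico 0 b, z x = 0) {s : Set ℝ} (hs : MeasurableSet s) :
    ∫ x in s ∩ Set.Ico 0 N, z x = 0 := by
  induction s, hs using MeasurableSpace.induction_on_inter
    (borel_eq_generateFrom_Iio ℝ ▸ BorelSpace.measurable_eq) isPiSystem_Iio with
  | empty => simp
  | basic t ht =>
    obtain ⟨b, rfl⟩ := ht
    rw [Set.inter_comm, Set.Ico_inter_Iio]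
    exact h _
  | compl t ht ih =>
    have h1 := integral_inter_add_sdiff (s := Set.Ico 0 N) ht hz
    rw [Set.inter_comm, ih, zero_add, h] at h1
    rwa [Set.inter_comm, ← Set.sdiff_eq]
  | iUnion f hd hm ih =>
    rw [Set.iUnion_inter, integral_iUnion (fun i => (hm i).inter measurableSet_Ico)
      (fun i j hij => (hd hij).mono Set.inter_subset_left Set.inter_subset_left)
      (hz.mono_set (Set.iUnion_subset fun i => Set.inter_subset_right))]
    simp [ih]

/-- Pairing with `c` times the indicator of `[0, b[` shows that `z` has zero integral over each such
interval, hence vanishes almost everywhere on every `[0, N[`. -/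
theorem isTotal_stepFunctions [CompleteSpace K] :
    IsTotal fun f : stepFunctions K => (f : L2 K (Set.Ici 0)) := by
  intro z hz
  have hint : ∀ N : ℝ, IntegrableOn z (Set.Ico 0 N) := fun N => by
    have h1 : MemLp z 2 (volume.restrict (Set.Ico 0 N)) :=
      (Lp.memLp z).mono_measure (Measure.restrict_mono (fun _ h => h.1) le_rfl)
    exact h1.integrable (by norm_num)
  have h0 : ∀ b : ℝ, ∫ x in Set.Ico 0 b, z x = 0 := by
    intro b
    refine ext_inner_left ℂ fun c => ?_
    have h1 := hz ⟨_, Submodule.subset_span ⟨0, b, c, le_rfl, rfl⟩⟩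
    rw [inner_zero_right, ← h1, L2.inner_indicatorConstLp_eq_inner_setIntegral,
      Measure.restrict_restrict_of_subset]
    exact fun _ h => h.1
  have hae : ∀ N : ℕ, ∀ᵐ x ∂volume.restrict (Set.Ico 0 (N : ℝ)), z x = 0 := by
    intro N
    refine Integrable.ae_eq_zero_of_forall_setIntegral_eq_zero (hint N) fun s hs _ => ?_
    rw [Measure.restrict_restrict hs]
    exact setIntegral_eq_zero_of_Ico (hint N) h0 hs
  have hU : (⋃ N : ℕ, Set.Ico 0 (N : ℝ)) = Set.Ici 0 := by
    ext x
    simp only [Set.mem_iUnion, Set.mem_Ico, Set.mem_Ici]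
    exact ⟨fun ⟨_, h⟩ => h.1, fun h => (exists_nat_gt x).imp fun _ h' => ⟨h, h'⟩⟩
  rw [Lp.eq_zero_iff_ae_eq_zero]
  have := (ae_restrict_iUnion_iff _ _).2 hae
  rwa [hU] at this

/-- Expanding `‖ε(g) - ε(f)‖²` leaves exponentials of inner products, continuous in `g`. -/
theorem continuous_expVec {V : Type*} [NormedAddCommGroup V] [InnerProductSpace ℂ V] :
    Continuous (expVec : V → Fock V) := by
  rw [continuous_iff_continuousAt]
  intro f
  rw [ContinuousAt, tendsto_iff_norm_sub_tendsto_zero]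
  have h : ∀ g : V, ‖expVec g - expVec f‖ = √(RCLike.re (Complex.exp ⟪g, g⟫_ℂ -
      Complex.exp ⟪g, f⟫_ℂ - Complex.exp ⟪f, g⟫_ℂ + Complex.exp ⟪f, f⟫_ℂ)) := fun g => by
    rw [@norm_eq_sqrt_re_inner ℂ, inner_sub_sub_self]
    simp only [inner_expVec]
  simp only [h]
  have hc : Continuous fun g : V => √(RCLike.re (Complex.exp ⟪g, g⟫_ℂ -
      Complex.exp ⟪g, f⟫_ℂ - Complex.exp ⟪f, g⟫_ℂ + Complex.exp ⟪f, f⟫_ℂ)) := by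
    have h1 : Continuous fun g : V => ⟪g, g⟫_ℂ := continuous_id.inner continuous_id
    have h2 : Continuous fun g : V => ⟪g, f⟫_ℂ := continuous_id.inner continuous_const
    have h3 : Continuous fun g : V => ⟪f, g⟫_ℂ := continuous_const.inner continuous_id
    exact (RCLike.continuous_re.comp
      (((h1.cexp.sub h2.cexp).sub h3.cexp).add continuous_const)).sqrt
  have := hc.tendsto f
  simpa using this

theorem isTotal_expVec_step [CompleteSpace K] :
    IsTotal fun f : stepFunctions K => expVec (f : L2 K (Set.Ici 0)) := by
  intro z hz
  refine isTotal_expVec z fun f => ?_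
  have hd : Dense (stepFunctions K : Set (L2 K (Set.Ici 0))) := by
    rw [Submodule.dense_iff_topologicalClosure_eq_top, Submodule.topologicalClosure_eq_top_iff,
      Submodule.eq_bot_iff]
    exact fun g hg => isTotal_stepFunctions g fun f => (Submodule.mem_orthogonal _ _).1 hg _ f.2
  have hcl : IsClosed {f : L2 K (Set.Ici 0) | ⟪expVec f, z⟫_ℂ = 0} :=
    isClosed_eq (continuous_expVec.inner continuous_const) continuous_const
  exact hd.closure_eq.symm.subset.trans (closure_minimal (fun f hf => hz ⟨f, hf⟩) hcl) trivial

end StepFunctions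

/-! ### Normalised exponential vectors -/

section Exponential

variable {V : Type*} [NormedAddCommGroup V] [InnerProductSpace ℂ V]

theorem inner_nexpVec_self (f : V) : ⟪nexpVec f, nexpVec f⟫_ℂ = 1 := by
  rw [inner_nexpVec, inner_self_eq_norm_sq_to_K, ← Real.exp_add]
  have : ((‖f‖ : ℂ) ^ 2) = ((‖f‖ ^ 2 : ℝ) : ℂ) := by push_cast; rfl
  change _ * Complex.exp ((‖f‖ : ℂ) ^ 2) = 1
  rw [this, ← Complex.ofReal_exp, ← Complex.ofReal_mul, ← Real.exp_add]
  ring_nf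
  simp

theorem slice_nexpVec {E : Type*} [NormedAddCommGroup E] [InnerProductSpace ℂ E] [CompleteSpace E]
    (f g : V) (X : HTensor E (Fock V) →L[ℂ] HTensor E (Fock V)) :
    slice (nexpVec f) (nexpVec g) X =
      ((Real.exp (-(‖f‖ ^ 2) / 2) * Real.exp (-(‖g‖ ^ 2) / 2) : ℝ) : ℂ) •
        slice (expVec f) (expVec g) X := by
  refine ContinuousLinearMap.ext fun w => ext_inner_left ℂ fun u => ?_
  rw [inner_slice, smul_apply, inner_smul_right, inner_slice, nexpVec, nexpVec, tmul_smul,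
    tmul_smul, map_smul, inner_smul_left, inner_smul_right, Complex.conj_ofReal]
  push_cast
  ring

end Exponential

/-! ### Past and future parts of a function -/

section Restrictions

variable {K : Type*} [NormedAddCommGroup K] [InnerProductSpace ℂ K] (t : ℝ≥0)
  (f g : L2 K (Set.Ici 0))

theorem coeFn_cut {J : Set ℝ} (hJ : MeasurableSet J) :
    cut f J hJ =ᵐ[volume.restrict (Set.Ici 0)] J.indicator f :=
  MemLp.coeFn_toLp _

theorem res_cut_of_subset {J J' : Set ℝ} (hJ : MeasurableSet J) (hJ' : MeasurableSet J')
    (h : J' ⊆ Set.Ici 0) (hsub : J' ⊆ J) : res h (cut f J hJ) = res h f := by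
  refine Lp.ext ((MemLp.coeFn_toLp _).trans (EventuallyEq.trans ?_ (MemLp.coeFn_toLp _).symm))
  filter_upwards [ae_restrict_of_ae_restrict_of_subset h (coeFn_cut f hJ),
    ae_restrict_mem hJ'] with s h1 h2
  rw [h1, Set.indicator_of_mem (hsub h2)]

theorem res_cut_of_disjoint {J J' : Set ℝ} (hJ : MeasurableSet J) (hJ' : MeasurableSet J')
    (h : J' ⊆ Set.Ici 0) (hd : Disjoint J' J) : res h (cut f J hJ) = 0 := by
  refine Lp.ext ((MemLp.coeFn_toLp _).trans (EventuallyEq.trans ?_ (Lp.coeFn_zero _ _ _).symm))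
  filter_upwards [ae_restrict_of_ae_restrict_of_subset h (coeFn_cut f hJ),
    ae_restrict_mem hJ'] with s h1 h2
  rw [h1, Set.indicator_of_notMem (Set.disjoint_left.1 hd h2)]
  rfl

theorem disjoint_Ico_Ici : Disjoint (Set.Ico 0 (t : ℝ)) (Set.Ici (t : ℝ)) :=
  Set.disjoint_left.2 fun _ h1 h2 => not_lt.2 h2 h1.2

theorem res_Ico_past : res (Ico_subset_Ici_zero t) (past t f) = res (Ico_subset_Ici_zero t) f :=
  res_cut_of_subset f _ measurableSet_Ico _ le_rfl

theorem res_Ici_past : res (Ici_subset_Ici_zero t) (past t f) = 0 :=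
  res_cut_of_disjoint f _ measurableSet_Ici _ (disjoint_Ico_Ici t).symm

theorem res_Ico_future : res (Ico_subset_Ici_zero t) (future t f) = 0 :=
  res_cut_of_disjoint f _ measurableSet_Ico _ (disjoint_Ico_Ici t)

theorem res_Ici_future :
    res (Ici_subset_Ici_zero t) (future t f) = res (Ici_subset_Ici_zero t) f :=
  res_cut_of_subset f _ measurableSet_Ici _ le_rfl

theorem inner_future : ⟪future t f, future t g⟫_ℂ =
    ⟪res (Ici_subset_Ici_zero t) f, res (Ici_subset_Ici_zero t) g⟫_ℂ := by
  rw [inner_res t, res_Ico_future, res_Ici_future, res_Ici_future, inner_zero_left, zero_add]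

theorem inner_past : ⟪past t f, past t g⟫_ℂ =
    ⟪res (Ico_subset_Ici_zero t) f, res (Ico_subset_Ici_zero t) g⟫_ℂ := by
  rw [inner_res t, res_Ico_past, res_Ico_past, res_Ici_past, inner_zero_left, add_zero]

theorem norm_sq_past_add_future : ‖past t f‖ ^ 2 + ‖future t f‖ ^ 2 = ‖f‖ ^ 2 := by
  have h : ⟪past t f, past t f⟫_ℂ + ⟪future t f, future t f⟫_ℂ = ⟪f, f⟫_ℂ := by
    rw [inner_past, inner_future, ← inner_res]
  simp only [inner_self_eq_norm_sq_to_K] at h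
  exact_mod_cast h

end Restrictions

/-! ### Conjugation by unitary operators -/

section Conjugation

variable {E : Type*} [NormedAddCommGroup E] [InnerProductSpace ℂ E]
  {E₁ : Type*} [NormedAddCommGroup E₁] [InnerProductSpace ℂ E₁]

theorem conjBy_apply (W : E ≃ₗᵢ[ℂ] E₁) (T : E →L[ℂ] E) (z : E₁) :
    conjBy W T z = W (T (W.symm z)) := rfl

theorem conjBy_mul (W : E ≃ₗᵢ[ℂ] E₁) (S T : E →L[ℂ] E) :
    conjBy W (S * T) = conjBy W S * conjBy W T :=
  ContinuousLinearMap.ext fun z => by simp [conjBy_apply]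

theorem inner_conjBy (W : E ≃ₗᵢ[ℂ] E₁) (T : E →L[ℂ] E) (x y : E₁) :
    ⟪x, conjBy W T y⟫_ℂ = ⟪W.symm x, T (W.symm y)⟫_ℂ := by
  rw [conjBy_apply, ← W.inner_map_map (W.symm x), W.apply_symm_apply]

theorem conjBy_symm_conjBy (W : E ≃ₗᵢ[ℂ] E₁) (T : E →L[ℂ] E) :
    conjBy W.symm (conjBy W T) = T :=
  ContinuousLinearMap.ext fun z => by simp [conjBy_apply]

theorem norm_conjBy_le (W : E ≃ₗᵢ[ℂ] E₁) (T : E →L[ℂ] E) : ‖conjBy W T‖ ≤ ‖T‖ :=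
  ContinuousLinearMap.opNorm_le_bound _ (norm_nonneg _) fun z => by
    rw [conjBy_apply, W.norm_map]
    exact (T.le_opNorm _).trans_eq (by rw [W.symm.norm_map])

theorem conjBy_star [CompleteSpace E] [CompleteSpace E₁] (W : E ≃ₗᵢ[ℂ] E₁) (T : E →L[ℂ] E) :
    conjBy W (star T) = star (conjBy W T) := by
  refine ContinuousLinearMap.ext fun y => ext_inner_left ℂ fun x => ?_
  rw [inner_conjBy, ContinuousLinearMap.star_eq_adjoint, ContinuousLinearMap.star_eq_adjoint,
    ContinuousLinearMap.adjoint_inner_right, ContinuousLinearMap.adjoint_inner_right,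
    ← inner_conj_symm, ← inner_conjBy, inner_conj_symm]

end Conjugation

/-! ### Adaptedness as ampliation from the past -/

section Adapted

universe u v

variable {H : Type u} [NormedAddCommGroup H] [InnerProductSpace ℂ H] [CompleteSpace H]
  {K : Type v} [NormedAddCommGroup K] [InnerProductSpace ℂ K]

/-- The operator `X` is of the form `x ⊗ I`, with `x` acting on `H ⊗ 𝓕_{[0, r[}`. -/
def IsAmpliation (r : ℝ≥0) (X : SysFock H K →L[ℂ] SysFock H K) : Prop :=
  ∃ x, conjBy (fockSplit r) X = opTensor x (ContinuousLinearMap.id ℂ _)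

variable {r : ℝ≥0} {X X' : SysFock H K →L[ℂ] SysFock H K}

theorem IsAmpliation.mul (h : IsAmpliation r X) (h' : IsAmpliation r X') :
    IsAmpliation r (X * X') := by
  obtain ⟨x, hx⟩ := h
  obtain ⟨x', hx'⟩ := h'
  refine ⟨x * x', ?_⟩
  rw [conjBy_mul, hx, hx']
  exact opTensor_comp _ _ _ _

theorem IsAmpliation.star (h : IsAmpliation r X) : IsAmpliation r (star X) := by
  obtain ⟨x, hx⟩ := h
  refine ⟨Star.star x, ?_⟩
  rw [conjBy_star, hx, star_opTensor]
  exact congrArg _ (star_one (Fock (L2 K (Set.Ici (r : ℝ))) →L[ℂ] Fock (L2 K (Set.Ici (r : ℝ)))))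

/-- The operator `x` with `X = x ⊗ I`. -/
def pastPart (r : ℝ≥0) (X : SysFock H K →L[ℂ] SysFock H K) :
    HTensor H (Fock (L2 K (Set.Ico 0 (r : ℝ)))) →L[ℂ]
      HTensor H (Fock (L2 K (Set.Ico 0 (r : ℝ)))) :=
  slice (nexpVec 0) (nexpVec 0) (conjBy (fockSplit r) X)

theorem pastPart_eq {x : HTensor H (Fock (L2 K (Set.Ico 0 (r : ℝ)))) →L[ℂ]
      HTensor H (Fock (L2 K (Set.Ico 0 (r : ℝ))))}
    (h : conjBy (fockSplit r) X = opTensor x (ContinuousLinearMap.id ℂ _)) :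
    pastPart r X = x := by
  rw [pastPart, h, slice_opTensor]
  change ⟪nexpVec 0, nexpVec 0⟫_ℂ • x = x
  rw [inner_nexpVec_self, one_smul]

theorem IsAmpliation.conjBy_eq (h : IsAmpliation r X) :
    conjBy (fockSplit r) X = opTensor (pastPart r X) (ContinuousLinearMap.id ℂ _) := by
  obtain ⟨x, hx⟩ := h
  rw [pastPart_eq hx, hx]

/-- Slicing with the vacuum is not multiplicative in general; it is on operators `x ⊗ I`, where it
recovers `x`. -/
theorem IsAmpliation.pastPart_mul (h : IsAmpliation r X) (h' : IsAmpliation r X') :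
    pastPart r (X * X') = pastPart r X * pastPart r X' := by
  refine pastPart_eq ?_
  rw [conjBy_mul, h.conjBy_eq, h'.conjBy_eq]
  exact opTensor_comp _ _ _ _

theorem pastPart_star : pastPart r (star X) = star (pastPart r X) := by
  rw [pastPart, conjBy_star, slice_star]; rfl

theorem inner_conjBy_fockSplit (u w : H) (f g : L2 K (Set.Ici 0)) :
    ⟪tmul (tmul u (expVec (res (Ico_subset_Ici_zero r) f)))
        (expVec (res (Ici_subset_Ici_zero r) f)),
      conjBy (fockSplit r) X (tmul (tmul w (expVec (res (Ico_subset_Ici_zero r) g)))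
        (expVec (res (Ici_subset_Ici_zero r) g)))⟫_ℂ =
      ⟪u, slice (expVec f) (expVec g) X w⟫_ℂ := by
  rw [← fockSplit_tmul, ← fockSplit_tmul, inner_conjBy, inner_slice,
    LinearIsometryEquiv.symm_apply_apply, LinearIsometryEquiv.symm_apply_apply]

/-- The normalising constants cancel because `‖f‖²` is the sum of the squared norms of the past and
future parts. -/
theorem slice_expVec_iff (f g : L2 K (Set.Ici 0)) :
    slice (nexpVec f) (nexpVec g) X = ⟪nexpVec (future r f), nexpVec (future r g)⟫_ℂ •
        slice (nexpVec (past r f)) (nexpVec (past r g)) X ↔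
      slice (expVec f) (expVec g) X = ⟪expVec (future r f), expVec (future r g)⟫_ℂ •
        slice (expVec (past r f)) (expVec (past r g)) X := by
  have h : ∀ f : L2 K (Set.Ici 0), Real.exp (-(‖f‖ ^ 2) / 2) =
      Real.exp (-(‖past r f‖ ^ 2) / 2) * Real.exp (-(‖future r f‖ ^ 2) / 2) := fun f => by
    rw [← Real.exp_add, ← norm_sq_past_add_future r f]
    ring_nf
  rw [slice_nexpVec, slice_nexpVec, inner_nexpVec, inner_expVec, h f, h g]
  have h2 : ((Real.exp (-(‖past r f‖ ^ 2) / 2) * Real.exp (-(‖future r f‖ ^ 2) / 2) *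
      (Real.exp (-(‖past r g‖ ^ 2) / 2) * Real.exp (-(‖future r g‖ ^ 2) / 2)) : ℝ) : ℂ) ≠ 0 :=
    Complex.ofReal_ne_zero.2 (by positivity)
  refine Iff.trans (Eq.congr_right ?_) (smul_right_injective _ h2).eq_iff
  rw [smul_smul, smul_smul]
  congr 1
  push_cast
  ring

theorem IsAmpliation.slice_eq (h : IsAmpliation r X) (f g : L2 K (Set.Ici 0)) :
    slice (expVec f) (expVec g) X = ⟪expVec (future r f), expVec (future r g)⟫_ℂ •
        slice (expVec (past r f)) (expVec (past r g)) X := by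
  obtain ⟨x, hx⟩ := h
  refine ContinuousLinearMap.ext fun w => ext_inner_left ℂ fun u => ?_
  rw [smul_apply, inner_smul_right, ← inner_conjBy_fockSplit (r := r),
    ← inner_conjBy_fockSplit (r := r), hx, opTensor_tmul, opTensor_tmul, inner_tmul, inner_tmul,
    res_Ico_past, res_Ico_past, res_Ici_past, res_Ici_past]
  simp only [ContinuousLinearMap.id_apply, inner_expVec, inner_future, inner_zero_left,
    Complex.exp_zero, mul_one]
  ring

variable [CompleteSpace K]

theorem isTotal_tmul_expVec_step : IsTotal fun p : H × stepFunctions K =>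
    tmul p.1 (expVec (p.2 : L2 K (Set.Ici 0))) :=
  IsTotal.tmul (x := fun u : H => u) (y := fun f : stepFunctions K => expVec (f : L2 K (Set.Ici 0)))
    (fun z hz => inner_self_eq_zero.1 (hz z)) isTotal_expVec_step

theorem isTotal_fockSplit_step (r : ℝ≥0) : IsTotal fun p : H × stepFunctions K =>
    tmul (tmul p.1 (expVec (res (Ico_subset_Ici_zero r) (p.2 : L2 K (Set.Ici 0)))))
        (expVec (res (Ici_subset_Ici_zero r) (p.2 : L2 K (Set.Ici 0)))) := by
  intro z hz
  have : (fockSplit r).symm z = 0 := isTotal_tmul_expVec_step _ fun p => by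
    rw [← (fockSplit r).inner_map_map, LinearIsometryEquiv.apply_symm_apply, fockSplit_tmul]
    exact hz p
  simpa using this

theorem isAmpliation_of_slice (h : ∀ f ∈ stepFunctions K, ∀ g ∈ stepFunctions K,
    slice (expVec f) (expVec g) X = ⟪expVec (future r f), expVec (future r g)⟫_ℂ •
        slice (expVec (past r f)) (expVec (past r g)) X) : IsAmpliation r X := by
  -- Past parts restrict to `0` on `[r, ∞[`, so their exponential vectors carry the vacuum `ε(0)` in
  -- the future factor; this forces the vacuum slice as the candidate.
  refine ⟨slice (expVec 0) (expVec 0) (conjBy (fockSplit r) X), ?_⟩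
  refine inner_ext_total (isTotal_fockSplit_step r) (isTotal_fockSplit_step r) fun p q => ?_
  rw [inner_conjBy_fockSplit, h _ q.2.2 _ p.2.2, smul_apply, inner_smul_right,
    ← inner_conjBy_fockSplit (r := r), opTensor_tmul, inner_tmul, inner_slice,
    res_Ico_past, res_Ico_past, res_Ici_past, res_Ici_past, mul_comm]
  congr 1
  rw [inner_expVec, inner_future]
  exact (inner_expVec _ _).symm

theorem isAdapted_iff {X : ℝ≥0 → (SysFock H K →L[ℂ] SysFock H K)} :
    IsAdapted X ↔ ∀ t, IsAmpliation t (X t) := by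
  constructor
  · exact fun h t => isAmpliation_of_slice fun f hf g hg => (slice_expVec_iff f g).1 (h f hf g hg t)
  · exact fun h f _ g _ t => (slice_expVec_iff f g).2 ((h t).slice_eq f g)

theorem isTotal_nexpVec_step :
    IsTotal fun f : stepFunctions K => nexpVec (f : L2 K (Set.Ici 0)) := by
  intro z hz
  refine isTotal_expVec_step z fun f => ?_
  have h : ⟪nexpVec (f : L2 K (Set.Ici 0)), z⟫_ℂ = 0 := hz f
  rw [nexpVec, inner_smul_left] at h
  exact (mul_eq_zero.1 h).resolve_left (by simp)

theorem IsBoundedProcess.mem_tensorAlg {A : VonNeumannAlgebra H}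
    {X : ℝ≥0 → (SysFock H K →L[ℂ] SysFock H K)} (h : IsBoundedProcess A X) (t : ℝ≥0) :
    X t ∈ tensorAlg (Fock (L2 K (Set.Ici 0))) A :=
  mem_tensorAlg_of_total isTotal_nexpVec_step fun f g => h.slice_mem f f.2 g g.2 t

end Adapted

/-! ### The shift `σ_r` as a unitary conjugation -/

section Shift

universe u v

variable {H : Type u} [NormedAddCommGroup H] [InnerProductSpace ℂ H] [CompleteSpace H]
  {K : Type v} [NormedAddCommGroup K] [InnerProductSpace ℂ K]

variable (H K) in
/-- The unitary operator `I ⊗ T_r`. -/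
def sysShift (r : ℝ≥0) : SysFock H K ≃ₗᵢ[ℂ] HTensor H (Fock (L2 K (Set.Ici (r : ℝ)))) :=
  unitaryOfGram (fun p : H × Fock (L2 K (Set.Ici 0)) => tmul p.1 p.2)
    (fun p => tmul p.1 (fockShift r p.2)) isTotal_tmul
    (fun z hz => isTotal_tmul z fun p => by
      have : ⟪tmul p.1 (fockShift r ((fockShift r).symm p.2)), z⟫_ℂ = 0 :=
        hz (p.1, (fockShift r).symm p.2)
      rwa [LinearIsometryEquiv.apply_symm_apply] at this)
    (fun p q => by rw [inner_tmul, inner_tmul, LinearIsometryEquiv.inner_map_map])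

theorem sysShift_tmul (r : ℝ≥0) (u : H) (ψ : Fock (L2 K (Set.Ici 0))) :
    sysShift H K r (tmul u ψ) = tmul u (fockShift r ψ) :=
  unitaryOfGram_apply (fun p : H × Fock (L2 K (Set.Ici 0)) => tmul p.1 p.2)
    (fun p => tmul p.1 (fockShift r p.2)) _ _ _ (u, ψ)

theorem sysShift_symm_tmul (r : ℝ≥0) (u : H) (ψ : Fock (L2 K (Set.Ici (r : ℝ)))) :
    (sysShift H K r).symm (tmul u ψ) = tmul u ((fockShift r).symm ψ) := by
  rw [LinearIsometryEquiv.symm_apply_eq, sysShift_tmul, LinearIsometryEquiv.apply_symm_apply]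

theorem sigma_eq (r : ℝ≥0) (X : SysFock H K →L[ℂ] SysFock H K) :
    sigma r X = conjBy (sysShift H K r) X := by
  have h1 : opTensor (ContinuousLinearMap.id ℂ H)
      ((fockShift (K := K) r).toContinuousLinearEquiv : Fock (L2 K (Set.Ici 0)) →L[ℂ] Fock (L2 K (Set.Ici (r : ℝ)))) =
        (sysShift H K r : SysFock H K →L[ℂ] HTensor H (Fock (L2 K (Set.Ici (r : ℝ))))) :=
    ext_tmul fun u ψ => by rw [opTensor_tmul]; exact (sysShift_tmul r u ψ).symm
  have h2 : opTensor (ContinuousLinearMap.id ℂ H)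
      ((fockShift (K := K) r).symm.toContinuousLinearEquiv : Fock (L2 K (Set.Ici (r : ℝ))) →L[ℂ] Fock (L2 K (Set.Ici 0))) =
        ((sysShift H K r).symm : HTensor H (Fock (L2 K (Set.Ici (r : ℝ)))) →L[ℂ] SysFock H K) :=
    ext_tmul fun u ψ => by rw [opTensor_tmul]; exact (sysShift_symm_tmul r u ψ).symm
  rw [sigma, h1, h2]
  rfl

/-- `I ⊗ T_r` leaves the system space alone, so a slice of `σ_r X` is the slice of `X` at the
vectors shifted back. -/
theorem sigma_mem_tensorAlg {A : VonNeumannAlgebra H} (r : ℝ≥0)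
    {X : SysFock H K →L[ℂ] SysFock H K} (hX : X ∈ tensorAlg (Fock (L2 K (Set.Ici 0))) A) :
    sigma r X ∈ tensorAlg (Fock (L2 K (Set.Ici (r : ℝ)))) A := by
  intro ψ χ
  have : slice ψ χ (sigma r X) = slice ((fockShift r).symm ψ) ((fockShift r).symm χ) X := by
    refine ContinuousLinearMap.ext fun w => ext_inner_left ℂ fun u => ?_
    rw [inner_slice, sigma_eq, inner_conjBy, sysShift_symm_tmul, sysShift_symm_tmul, inner_slice]
  rw [this]
  exact hX _ _

end Shift

/-! ### Continuity and local boundedness of operator families -/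

section Continuity

variable {E : Type*} [NormedAddCommGroup E] [InnerProductSpace ℂ E]

theorem continuous_inner_apply {α : Type*} [TopologicalSpace α] {T : α → E →L[ℂ] E} {C : ℝ}
    (hC : ∀ t, ‖T t‖ ≤ C) (hT : ∀ x y, Continuous fun t => ⟪x, T t y⟫_ℂ) {x y : α → E}
    (hx : Continuous x) (hy : Continuous y) : Continuous fun t => ⟪x t, T t (y t)⟫_ℂ := by
  rw [continuous_iff_continuousAt]
  intro s
  -- The increment splits into a change of `x`, a change of `y`, and a change of `T` between fixed
  -- vectors; the uniform bound handles the first two.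
  have h1 : Tendsto (fun t => ⟪x t - x s, T t (y t)⟫_ℂ) (𝓝 s) (𝓝 0) := by
    refine squeeze_zero_norm (a := fun t => ‖x t - x s‖ * (C * ‖y t‖)) (fun t => ?_) ?_
    · exact (norm_inner_le_norm _ _).trans (by gcongr; exact (T t).le_of_opNorm_le (hC t) _)
    · have : Continuous fun t => ‖x t - x s‖ * (C * ‖y t‖) := by fun_prop
      simpa using this.tendsto s
  have h2 : Tendsto (fun t => ⟪x s, T t (y t - y s)⟫_ℂ) (𝓝 s) (𝓝 0) := by
    refine squeeze_zero_norm (a := fun t => ‖x s‖ * (C * ‖y t - y s‖)) (fun t => ?_) ?_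
    · exact (norm_inner_le_norm _ _).trans (by gcongr; exact (T t).le_of_opNorm_le (hC t) _)
    · have : Continuous fun t => ‖x s‖ * (C * ‖y t - y s‖) := by fun_prop
      simpa using this.tendsto s
  have h3 := (h1.add h2).add ((hT (x s) (y s)).tendsto s)
  rw [zero_add, zero_add] at h3
  refine h3.congr fun t => ?_
  rw [inner_sub_left, map_sub, inner_sub_right]
  ring

theorem exists_norm_le_of_strongly_continuous [CompleteSpace E] {Y : ℝ≥0 → E →L[ℂ] E}
    (hY : ∀ z, Continuous fun t => Y t z) (T : ℝ≥0) : ∃ C, 1 ≤ C ∧ ∀ t ≤ T, ‖Y t‖ ≤ C := by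
  obtain ⟨C, hC⟩ := banach_steinhaus (g := fun t : Set.Icc 0 T => Y t) fun z => by
    obtain ⟨C, hC⟩ := (isCompact_Icc (a := 0) (b := T)).exists_bound_of_continuousOn
      (hY z).continuousOn
    exact ⟨C, fun t => hC t t.2⟩
  -- The bound is kept at least `1` so that its powers increase in the growth estimate.
  exact ⟨max 1 C, le_max_left _ _, fun t ht => (hC ⟨t, zero_le, ht⟩).trans (le_max_right _ _)⟩

end Continuity

theorem IsNormal.slice_conjBy {E E₁ E₂ G : Type*}
    [NormedAddCommGroup E] [InnerProductSpace ℂ E] [CompleteSpace E]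
    [NormedAddCommGroup E₁] [InnerProductSpace ℂ E₁] [CompleteSpace E₁]
    [NormedAddCommGroup E₂] [InnerProductSpace ℂ E₂] [CompleteSpace E₂]
    [NormedAddCommGroup G] [InnerProductSpace ℂ G] {A : VonNeumannAlgebra E}
    {φ : A.toStarSubalgebra →ₗ[ℂ] (E₁ →L[ℂ] E₁)} (hφ : IsNormal φ) (W : E₁ ≃ₗᵢ[ℂ] HTensor E₂ G)
    (ψ χ : G) {φ' : A.toStarSubalgebra →ₗ[ℂ] (E₂ →L[ℂ] E₂)}
    (h : ∀ a, φ' a = slice ψ χ (conjBy W (φ a))) : IsNormal φ' :=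
  hφ.comp (bra ψ ∘L (W : E₁ →L[ℂ] HTensor E₂ G)) ((W.symm : HTensor E₂ G →L[ℂ] E₁) ∘L ket χ) h

/-! ### The perturbed flow -/

section Flow

universe u v

variable {H : Type u} [NormedAddCommGroup H] [InnerProductSpace ℂ H] [CompleteSpace H]
  {K : Type v} [NormedAddCommGroup K] [InnerProductSpace ℂ K]
  {A : VonNeumannAlgebra H}
  {j : ℝ≥0 → (A.toStarSubalgebra →ₗ[ℂ] (SysFock H K →L[ℂ] SysFock H K))}
  {X X' : SysFock H K →L[ℂ] SysFock H K}

theorem IsQSFlow.isStarHom (hj : IsQSFlow A j) (t : ℝ≥0) : IsStarHom (j t) :=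
  ⟨hj.map_mul t, hj.map_star t⟩

theorem isNormal_pastMap {r : ℝ≥0} (h : IsNormal (j r)) : IsNormal (pastMap j r) :=
  h.slice_conjBy (fockSplit r) (nexpVec 0) (nexpVec 0) fun _ => rfl

variable {Y Z : ℝ≥0 → (SysFock H K →L[ℂ] SysFock H K)}

theorem perturbation_apply (t : ℝ≥0) (a : A.toStarSubalgebra) :
    perturbation j Y Z t a = star (Y t) * j t a * Z t := rfl

/-- The matrix element is `⟪Y_t x, j_t(a) Z_t y⟫`, so strong continuity of `Y` is used rather than
that of its adjoint. -/
theorem continuous_inner_perturbation (hj : IsQSFlow A j) (hY : IsStronglyContinuous Y)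
    (hZ : IsStronglyContinuous Z) (a : A.toStarSubalgebra) (x y : SysFock H K) :
    Continuous fun t => ⟪x, perturbation j Y Z t a y⟫_ℂ := by
  have h := continuous_inner_apply (fun t => (hj.isStarHom t).norm_le a)
    (fun x y => @Continuous.comp _ _ _ _ (ultraweak (SysFock H K)) _ _ _
      (continuous_inner_ultraweak x y) (hj.continuous a)) (hY x) (hZ y)
  refine h.congr fun t => ?_
  exact (ContinuousLinearMap.adjoint_inner_right (Y t) _ _).symm

theorem isUltraweaklyContinuous_perturbation (hj : IsQSFlow A j) (hY : IsStronglyContinuous Y)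
    (hZ : IsStronglyContinuous Z) : IsUltraweaklyContinuous (perturbation j Y Z) := by
  intro a
  refine continuous_ultraweak_iff.2 fun u v => continuous_iff_continuousAt.2 fun s => ?_
  -- Bounds up to time `s + 1` hold on a neighbourhood of `s`, where ultraweak convergence reduces
  -- to weak convergence.
  obtain ⟨C, -, hC⟩ := exists_norm_le_of_strongly_continuous hY (s + 1)
  obtain ⟨D, -, hD⟩ := exists_norm_le_of_strongly_continuous hZ (s + 1)
  refine tendsto_tsum_inner (C := C * ‖(a : H →L[ℂ] H)‖ * D) ?_
    (fun x y => (continuous_inner_perturbation hj hY hZ a x y).tendsto s) u v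
  filter_upwards [Iic_mem_nhds (show s < s + 1 from lt_add_of_pos_right s one_pos)] with t ht
  have h1 : ‖star (Y t)‖ ≤ C := (norm_star _).trans_le (hC t ht)
  have h0 : 0 ≤ C := (norm_nonneg _).trans h1
  refine (norm_mul_le _ _).trans ?_
  gcongr
  · refine (norm_mul_le _ _).trans ?_
    gcongr
    exact (hj.isStarHom t).norm_le a
  · exact hD t ht

variable [CompleteSpace K]

theorem IsQSFlow.isAmpliation (hj : IsQSFlow A j) (t : ℝ≥0) (a : A.toStarSubalgebra) :
    IsAmpliation t (j t a) :=
  isAdapted_iff.1 (hj.process a).adapted t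

theorem IsQSFlow.isStarHom_pastMap (hj : IsQSFlow A j) (r : ℝ≥0) : IsStarHom (pastMap j r) where
  map_mul a b := by
    change pastPart r (j r (a * b)) = pastPart r (j r a) * pastPart r (j r b)
    rw [hj.map_mul, (hj.isAmpliation r a).pastPart_mul (hj.isAmpliation r b)]
  map_star a := by
    change pastPart r (j r (star a)) = star (pastPart r (j r a))
    rw [hj.map_star, pastPart_star]

/-- The shift is a conjugation, and the past map is a normal `⋆`-homomorphism because `j_r(a)` is an
ampliation, so `tensorId_mul` applies. -/
theorem IsQSFlow.kHat_sigma_mul (hj : IsQSFlow A j) (r : ℝ≥0)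
    (hX : X ∈ tensorAlg (Fock (L2 K (Set.Ici 0))) A)
    (hX' : X' ∈ tensorAlg (Fock (L2 K (Set.Ici 0))) A) :
    kHat j r (sigma r (X * X')) = kHat j r (sigma r X) * kHat j r (sigma r X') := by
  rw [kHat, sigma_eq, conjBy_mul, ← sigma_eq, ← sigma_eq,
    tensorId_mul (hj.isStarHom_pastMap r) (isNormal_pastMap (hj.normal r))
      (sigma_mem_tensorAlg r hX) (sigma_mem_tensorAlg r hX'), conjBy_mul]
  rfl

theorem IsQSFlow.kHat_sigma_star (hj : IsQSFlow A j) (r : ℝ≥0)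
    (hX : X ∈ tensorAlg (Fock (L2 K (Set.Ici 0))) A) :
    kHat j r (sigma r (star X)) = star (kHat j r (sigma r X)) := by
  rw [kHat, sigma_eq, conjBy_star, ← sigma_eq,
    tensorId_star (hj.isStarHom_pastMap r) (sigma_mem_tensorAlg r hX), conjBy_star]
  rfl

theorem IsQSFlow.norm_kHat_sigma_le (hj : IsQSFlow A j) (r : ℝ≥0)
    (hX : X ∈ tensorAlg (Fock (L2 K (Set.Ici 0))) A) : ‖kHat j r (sigma r X)‖ ≤ ‖X‖ := by
  refine (norm_conjBy_le _ _).trans ?_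
  refine (norm_tensorId_le (hj.isStarHom_pastMap r) (sigma_mem_tensorAlg r hX)).trans ?_
  rw [sigma_eq]
  exact norm_conjBy_le _ _

theorem pastMap_perturbation (hj : IsQSFlow A j) {r : ℝ≥0} (hY : IsAmpliation r (Y r))
    (hZ : IsAmpliation r (Z r)) (a : A.toStarSubalgebra) :
    pastMap (perturbation j Y Z) r a =
      star (pastPart r (Y r)) * pastMap j r a * pastPart r (Z r) := by
  change pastPart r (star (Y r) * j r a * Z r) = _ * pastPart r (j r a) * _
  rw [(hY.star.mul (hj.isAmpliation r a)).pastPart_mul hZ,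
    hY.star.pastPart_mul (hj.isAmpliation r a), pastPart_star]

/-- Multiplying by `y⋆ ⊗ I` and `z ⊗ I` multiplies every slice by `y⋆` and `z`, which matches the
effect of the perturbation on the past map. Uniqueness of `tensorId` then concludes. -/
theorem kHat_perturbation (hj : IsQSFlow A j) {r : ℝ≥0} (hY : IsAmpliation r (Y r))
    (hZ : IsAmpliation r (Z r)) (hX : X ∈ tensorAlg (Fock (L2 K (Set.Ici 0))) A) :
    kHat (perturbation j Y Z) r (sigma r X) = star (Y r) * kHat j r (sigma r X) * Z r := by
  have hT := isTensorId_tensorId (hj.isStarHom_pastMap r) (sigma_mem_tensorAlg r hX)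
  have h : tensorId (pastMap (perturbation j Y Z) r) (sigma r X) =
      opTensor (star (pastPart r (Y r))) (ContinuousLinearMap.id ℂ _) *
        tensorId (pastMap j r) (sigma r X) *
          opTensor (pastPart r (Z r)) (ContinuousLinearMap.id ℂ _) := by
    refine tensorId_eq fun ψ χ => ?_
    obtain ⟨h1, h2⟩ := hT ψ χ
    refine ⟨h1, ?_⟩
    rw [slice_mul_opTensor, slice_opTensor_mul, h2, pastMap_perturbation hj hY hZ]
  have hs : conjBy (fockSplit r) (star (Y r)) =
      opTensor (star (pastPart r (Y r))) (ContinuousLinearMap.id ℂ _) := by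
    rw [hY.star.conjBy_eq, pastPart_star]
  rw [kHat, h, conjBy_mul, conjBy_mul, ← hs, ← hZ.conjBy_eq, conjBy_symm_conjBy,
    conjBy_symm_conjBy]
  rfl

theorem IsMultiplierCocycle.isAmpliation (hY : IsMultiplierCocycle A j Y) (t : ℝ≥0) :
    IsAmpliation t (Y t) :=
  isAdapted_iff.1 hY.adapted t

theorem perturbation_mem_tensorAlg (hj : IsQSFlow A j) (hY : IsMultiplierCocycle A j Y)
    (hZ : IsMultiplierCocycle A j Z) (t : ℝ≥0) (a : A.toStarSubalgebra) :
    perturbation j Y Z t a ∈ tensorAlg (Fock (L2 K (Set.Ici 0))) A :=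
  mul_mem_tensorAlg (mul_mem_tensorAlg (star_mem_tensorAlg (hY.mem_tensorAlg t))
    ((hj.process a).mem_tensorAlg t)) (hZ.mem_tensorAlg t)

theorem perturbation_add (hj : IsQSFlow A j) (hY : IsMultiplierCocycle A j Y)
    (hZ : IsMultiplierCocycle A j Z) (r t : ℝ≥0) (a : A.toStarSubalgebra) :
    perturbation j Y Z (r + t) a =
      kHat (perturbation j Y Z) r (sigma r (perturbation j Y Z t a)) := by
  have hYt := hY.mem_tensorAlg t
  have hja := (hj.process a).mem_tensorAlg t
  rw [kHat_perturbation hj (hY.isAmpliation r) (hZ.isAmpliation r)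
      (perturbation_mem_tensorAlg hj hY hZ t a), perturbation_apply, perturbation_apply,
    hj.kHat_sigma_mul r (mul_mem_tensorAlg (star_mem_tensorAlg hYt) hja) (hZ.mem_tensorAlg t),
    hj.kHat_sigma_mul r (star_mem_tensorAlg hYt) hja, hj.kHat_sigma_star r hYt, hY.add, hZ.add,
    hj.add, star_mul]
  simp only [mul_assoc]

theorem isQSCocycle_perturbation (hj : IsQSFlow A j) (hY : IsMultiplierCocycle A j Y)
    (hZ : IsMultiplierCocycle A j Z)
    (hm : ∀ a : A.toStarSubalgebra, IsWeaklyMeasurable fun t => perturbation j Y Z t a) :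
    IsQSCocycle A (perturbation j Y Z) where
  process a :=
    { adapted := isAdapted_iff.2 fun t =>
        ((hY.isAmpliation t).star.mul (hj.isAmpliation t a)).mul (hZ.isAmpliation t)
      weaklyMeasurable := hm a
      slice_mem := fun _ _ _ _ t => perturbation_mem_tensorAlg hj hY hZ t a _ _ }
  normal t := (hj.normal t).comp (star (Y t)) (Z t) fun _ => rfl
  completelyBounded t := ⟨_, (hj.isStarHom t).cbNormLE_sandwich (Y t) (Z t)⟩
  zero a := by rw [perturbation_apply, hY.zero, hZ.zero, star_one, one_mul, mul_one, hj.zero]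
  add := perturbation_add hj hY hZ

/-- Since `J_1` is contractive, `‖Y_{1+s}‖ ≤ ‖Y_s‖ ‖Y_1‖`; a bound `M` on `[0, 1]` thus gives
`M^(n+1)` on `[0, n+1]`. -/
theorem IsMultiplierCocycle.exists_norm_le (hj : IsQSFlow A j) (hY : IsMultiplierCocycle A j Y)
    (hc : IsStronglyContinuous Y) :
    ∃ M ≥ (1 : ℝ), ∃ β : ℝ, ∀ t : ℝ≥0, ‖Y t‖ ≤ M * Real.exp (β * t) := by
  obtain ⟨M, hM, hb⟩ := exists_norm_le_of_strongly_continuous hc 1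
  have hM0 : 0 < M := one_pos.trans_le hM
  have key : ∀ (n : ℕ) (t : ℝ≥0), t ≤ n + 1 → ‖Y t‖ ≤ M ^ (n + 1) := by
    intro n
    induction n with
    | zero => intro t ht; simpa using hb t (by simpa using ht)
    | succ n ih =>
      intro t ht
      rcases le_total t 1 with h1 | h1
      · exact (hb t h1).trans (le_self_pow₀ hM (by omega))
      · obtain ⟨s, rfl⟩ := exists_add_of_le h1
        have hs : s ≤ n + 1 := by
          rw [add_comm 1 s] at ht
          push_cast at ht
          exact le_of_add_le_add_right ht
        rw [hY.add, pow_succ M (n + 1)]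
        refine (norm_mul_le _ _).trans ?_
        gcongr
        · exact (hj.norm_kHat_sigma_le 1 (hY.mem_tensorAlg s)).trans (ih s hs)
        · exact hb 1 le_rfl
  -- With `n = ⌊t⌋`, one factor `M` becomes the constant, and `M^n ≤ exp(t log M)` because `n ≤ t`
  -- and `M ≥ 1`.
  refine ⟨M, hM, Real.log M, fun t => (key ⌊t⌋₊ t (Nat.lt_floor_add_one t).le).trans ?_⟩
  rw [pow_succ', ← Real.rpow_def_of_pos hM0, ← Real.rpow_natCast]
  gcongr
  exact_mod_cast Nat.floor_le (zero_le (a := t))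

theorem isExponentiallyCB_perturbation (hj : IsQSFlow A j) (hY : IsMultiplierCocycle A j Y)
    (hZ : IsMultiplierCocycle A j Z) (hYc : IsStronglyContinuous Y)
    (hZc : IsStronglyContinuous Z) : IsExponentiallyCB (perturbation j Y Z) := by
  obtain ⟨M, hM, β, h⟩ := hY.exists_norm_le hj hYc
  obtain ⟨M', hM', β', h'⟩ := hZ.exists_norm_le hj hZc
  refine ⟨M * M', one_le_mul_of_one_le_of_one_le hM hM', β + β', fun t n a => ?_⟩
  refine ((hj.isStarHom t).cbNormLE_sandwich (Y t) (Z t) n a).trans ?_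
  refine mul_le_mul_of_nonneg_right ?_ (norm_nonneg _)
  calc ‖Y t‖ * ‖Z t‖ ≤ (M * Real.exp (β * t)) * (M' * Real.exp (β' * t)) := by
        gcongr
        · exact h t
        · exact h' t
    _ = M * M' * Real.exp ((β + β') * t) := by rw [add_mul, Real.exp_add]; ring

end Flow
end QS

end

theorem mainTheorem12
    {H : Type*} [NormedAddCommGroup H] [InnerProductSpace ℂ H] [CompleteSpace H]
    {K : Type*} [NormedAddCommGroup K] [InnerProductSpace ℂ K] [CompleteSpace K]
    (A : VonNeumannAlgebra H)
    (j : ℝ≥0 → (A.toStarSubalgebra →ₗ[ℂ] (QS.SysFock H K →L[ℂ] QS.SysFock H K)))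
    (hj : QS.IsQSFlow A j)
    (Y Z : ℝ≥0 → (QS.SysFock H K →L[ℂ] QS.SysFock H K))
    (hY : QS.IsMultiplierCocycle A j Y) (hZ : QS.IsMultiplierCocycle A j Z) :
    ((∀ a : A.toStarSubalgebra,
        QS.IsWeaklyMeasurable fun t => QS.perturbation j Y Z t a) →
      QS.IsQSCocycle A (QS.perturbation j Y Z)) ∧
    (QS.IsStronglyContinuous Y → QS.IsStronglyContinuous Z →
      QS.IsQSCocycle A (QS.perturbation j Y Z) ∧
      QS.IsUltraweaklyContinuous (QS.perturbation j Y Z) ∧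
      QS.IsExponentiallyCB (QS.perturbation j Y Z)) :=
  ⟨QS.isQSCocycle_perturbation hj hY hZ, fun hYc hZc =>
    -- Under strong continuity the matrix elements are continuous, which supplies the measurability
    -- assumed in the first part.
    ⟨QS.isQSCocycle_perturbation hj hY hZ fun a x y _ =>
      (QS.continuous_inner_perturbation hj hYc hZc a x y).measurable,
    QS.isUltraweaklyContinuous_perturbation hj hYc hZc,
    QS.isExponentiallyCB_perturbation hj hY hZ hYc hZc⟩⟩
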